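/- For bounded real sequences $a,b$ on $\mathbb Z$ with $\inf_n a_n>0$, let $\mathscr J=\mathscr J_{a,b}$ be the Jacobi matrix on $\ell^2(\mathbb Z)$, $(\mathscr J\varphi)_n=a_{n-1}\varphi_{n-1}+b_n\varphi_n+a_n\varphi_{n+1}$. For $R>0$ let $\mathcal J(R)$ be the set of all such $\mathscr J$ with $\|\mathscr J\|\le R$ and $\inf_n a_n\ge R^{-1}$. Call $\mathscr J$ $q$-periodic, for an integer $q\ge 1$, if $a_{n+q}=a_n$ and $b_{n+q}=b_n$ for all $n\in\mathbb Z$. For a $q$-periodic $\mathscr J$ and $\theta\in\mathbb R/2\pi\mathbb Z$ let $\mathscr J_\theta$ and $A_\theta$ be the Hermitian $q\times q$ matrices $$\mathscr J_\theta=\sum_{j=1}^q b_jE_{j,j}+\sum_{j=1}^{q-1}a_j\,(E_{j,j+1}+E_{j+1,j})+a_q\,(e^{-i\theta}E_{1,q}+e^{i\theta}E_{q,1}),$$ $$A_\theta=\sum_{j=1}^{q-1}i a_j\,(E_{j,j+1}-E_{j+1,j})-i a_q\,(e^{-i\theta}E_{1,q}-e^{i\theta}E_{q,1}),$$ where $E_{j,k}$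 are the matrix units (terms falling on the same entry are added when $q\le 2$). They are the Floquet fibers of $\mathscr J$ and of $A=i[\mathscr J,X]$, where $(X\varphi)_n=n\varphi_n$ is the position operator. Let $\lambda_1(\theta)\le\dots\le\lambda_q(\theta)$ be the eigenvalues of $\mathscr J_\theta$ counted with multiplicity, which are differentiable functions of $\theta\notin\{0,\pi\}$, let $P_j(\theta)$ be the orthogonal projection of $\mathbb C^q$ onto $\ker(\mathscr J_\theta-\lambda_j(\theta))$, and for $\theta\notin\{0,\pi\}$ let $$Q_\theta=q\sum_{j=1}^q\lambda_j'(\theta)\,P_j(\theta),$$ the fiber of the asymptotic velocity operator. Theorem. For every $R>0$ there exists a constant $C_1=C_1(R)>1$ such that for every $q\ge1$, every $q$-periodic Jacobi matrix $\mathscr J\in\mathcal J(R)$ and every $t>0$, $$\left(\int_0^{2\pi}\left\|Q_\theta-\frac1t\int_0^t e^{is\mathscr J_\theta}A_\theta e^{-is\mathscr J_\theta}\,ds\right\|^2\frac{d\theta}{2\pi}\right)^{1/2}\le C_1^{\,q}\,t^{-1/5},$$ where $\|\cdot\|$ is the operator norm on $\mathbb C^q$ with the Euclidean norm. -/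

import Mathlib

open MeasureTheory Set

noncomputable section

/-- The Hilbert space `ℓ²(ℤ)` of square summable complex sequences. -/
abbrev EllTwo : Type := lp (fun _ : ℤ => ℂ) 2

theorem sum_weightedShift_le {c : ℤ → ℝ} {C : ℝ} (hc : ∀ n, |c n| ≤ C) (k : ℤ) (φ : EllTwo)
    (s : Finset ℤ) :
    ∑ n ∈ s, ‖(c n : ℂ) * φ (n + k)‖ ^ (2 : ENNReal).toReal
      ≤ (C * ‖φ‖) ^ (2 : ENNReal).toReal := by
  have hC : 0 ≤ C := (abs_nonneg _).trans (hc 0)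
  have h2 : 0 < (2 : ENNReal).toReal := by norm_num
  rw [Real.mul_rpow hC (norm_nonneg _)]
  calc ∑ n ∈ s, ‖(c n : ℂ) * φ (n + k)‖ ^ (2 : ENNReal).toReal
      ≤ ∑ n ∈ s, C ^ (2 : ENNReal).toReal * ‖φ (n + k)‖ ^ (2 : ENNReal).toReal := by
        refine Finset.sum_le_sum fun n _ => ?_
        rw [norm_mul, Real.mul_rpow (norm_nonneg _) (norm_nonneg _), Complex.norm_real,
          Real.norm_eq_abs]
        exact mul_le_mul_of_nonneg_right (Real.rpow_le_rpow (abs_nonneg _) (hc n) h2.le)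
          (by positivity)
    _ = C ^ (2 : ENNReal).toReal *
          ∑ m ∈ s.map (addRightEmbedding k), ‖φ m‖ ^ (2 : ENNReal).toReal := by
        rw [Finset.sum_map, Finset.mul_sum]; rfl
    _ ≤ _ := mul_le_mul_of_nonneg_left (lp.sum_rpow_le_norm_rpow h2 φ _) (by positivity)

/-- The bounded operator `φ ↦ (n ↦ c n * φ (n + k))` on `ℓ²(ℤ)`, for a bounded real sequence
`c`. -/
def weightedShift (k : ℤ) (c : ℤ → ℝ) (hc : ∃ C : ℝ, ∀ n, |c n| ≤ C) : EllTwo →L[ℂ] EllTwo :=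
  LinearMap.mkContinuousOfExistsBound
    { toFun := fun φ => ⟨fun n => (c n : ℂ) * φ (n + k),
        memℓp_gen' (fun s => sum_weightedShift_le hc.choose_spec k φ s)⟩
      map_add' := fun φ ψ => by
        ext n; exact mul_add (c n : ℂ) (φ (n + k)) (ψ (n + k))
      map_smul' := fun z φ => by
        ext n; exact mul_left_comm (c n : ℂ) z (φ (n + k)) }
    (by
      obtain ⟨C, hC⟩ := hc
      refine ⟨C, fun φ => ?_⟩
      have hC0 : 0 ≤ C := (abs_nonneg _).trans (hC 0)
      exact lp.norm_le_of_forall_sum_le (by norm_num) (by positivity)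
        (fun s => sum_weightedShift_le hC k φ s))

/-- The coefficients of a Jacobi matrix on `ℓ²(ℤ)`: bounded real sequences `a`, `b` with
`inf a > 0`. -/
structure JacobiMatrix where
  /-- the off-diagonal coefficients -/
  a : ℤ → ℝ
  /-- the diagonal coefficients -/
  b : ℤ → ℝ
  a_bdd : ∃ C : ℝ, ∀ n, |a n| ≤ C
  b_bdd : ∃ C : ℝ, ∀ n, |b n| ≤ C
  a_pos : ∃ c : ℝ, 0 < c ∧ ∀ n, c ≤ a n

namespace JacobiMatrix

/-- The bounded operator `(J φ)ₙ = aₙ₋₁ φₙ₋₁ + bₙ φₙ + aₙ φₙ₊₁` on `ℓ²(ℤ)`. -/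
def op (J : JacobiMatrix) : EllTwo →L[ℂ] EllTwo :=
  weightedShift (-1) (fun n => J.a (n - 1)) (J.a_bdd.imp fun _ h n => h (n - 1))
    + weightedShift 0 J.b J.b_bdd + weightedShift 1 J.a J.a_bdd

theorem op_apply (J : JacobiMatrix) (φ : EllTwo) (n : ℤ) :
    J.op φ n = (J.a (n - 1) : ℂ) * φ (n - 1) + (J.b n : ℂ) * φ n + (J.a n : ℂ) * φ (n + 1) := by
  have h : J.op φ n = (J.a (n - 1) : ℂ) * φ (n + -1) + (J.b n : ℂ) * φ (n + 0)
    + (J.a n : ℂ) * φ (n + 1) := rfl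
  rw [h, add_zero, ← sub_eq_add_neg]

/-- The class of Jacobi matrices with operator norm at most `R` and off-diagonal coefficients at
least `R⁻¹`. -/
def boundedClass (R : ℝ) : Set JacobiMatrix :=
  {J | ‖J.op‖ ≤ R ∧ ∀ n, R⁻¹ ≤ J.a n}

/-- `q`-periodicity; `q` need not be the least period. -/
def IsPeriodic (J : JacobiMatrix) (q : ℕ) : Prop :=
  0 < q ∧ (∀ n, J.a (n + q) = J.a n) ∧ ∀ n, J.b (n + q) = J.b n

/-- The Floquet matrix `J_θ`. The row and column `j : Fin q` belong to the site `j + 1`, so the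
sites are `1, …, q`. Contributions to the same entry are added, which matters for `q ≤ 2` only. -/
def floquet (J : JacobiMatrix) (q : ℕ) (θ : ℝ) : Matrix (Fin q) (Fin q) ℂ :=
  Matrix.of fun j k =>
    (if j = k then (J.b ((j : ℤ) + 1) : ℂ) else 0)
    + (if (k : ℕ) = j + 1 then (J.a ((j : ℤ) + 1) : ℂ) else 0)
    + (if (j : ℕ) = k + 1 then (J.a ((k : ℤ) + 1) : ℂ) else 0)
    + (if (j : ℕ) = 0 ∧ (k : ℕ) + 1 = q then
        Complex.exp (-(Complex.I * θ)) * (J.a q : ℂ) else 0)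
    + (if (j : ℕ) + 1 = q ∧ (k : ℕ) = 0 then
        Complex.exp (Complex.I * θ) * (J.a q : ℂ) else 0)

/-- The fibre `A_θ` of the velocity operator `A = i[J, X]`, where `X` is the position operator:
`(A φ)ₙ = i (aₙ φₙ₊₁ - aₙ₋₁ φₙ₋₁)`. -/
def velocity (J : JacobiMatrix) (q : ℕ) (θ : ℝ) : Matrix (Fin q) (Fin q) ℂ :=
  Matrix.of fun j k =>
    (if (k : ℕ) = j + 1 then Complex.I * (J.a ((j : ℤ) + 1) : ℂ) else 0)
    + (if (j : ℕ) = k + 1 then -(Complex.I * (J.a ((k : ℤ) + 1) : ℂ)) else 0)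
    + (if (j : ℕ) = 0 ∧ (k : ℕ) + 1 = q then
        -(Complex.I * Complex.exp (-(Complex.I * θ)) * (J.a q : ℂ)) else 0)
    + (if (j : ℕ) + 1 = q ∧ (k : ℕ) = 0 then
        Complex.I * Complex.exp (Complex.I * θ) * (J.a q : ℂ) else 0)

theorem floquet_isHermitian (J : JacobiMatrix) (q : ℕ) (θ : ℝ) :
    (J.floquet q θ).IsHermitian := by
  ext j k
  have e1 : (starRingEnd ℂ) (Complex.exp (-(Complex.I * θ))) = Complex.exp (Complex.I * θ) := by
    rw [← Complex.exp_conj]; simp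
  have e2 : (starRingEnd ℂ) (Complex.exp (Complex.I * θ)) = Complex.exp (-(Complex.I * θ)) := by
    rw [← Complex.exp_conj]; simp
  simp only [Matrix.conjTranspose_apply, floquet, Matrix.of_apply, RCLike.star_def, map_add,
    apply_ite (starRingEnd ℂ), map_zero, Complex.conj_ofReal, map_mul, e1, e2]
  have h1 : (if k = j then (J.b ((k : ℤ) + 1) : ℂ) else 0)
      = if j = k then (J.b ((j : ℤ) + 1) : ℂ) else 0 := by
    by_cases h : j = k
    · subst h; rfl
    · rw [if_neg h, if_neg (Ne.symm h)]
  rw [h1]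
  simp only [and_comm]
  ring

/-- The Floquet eigenvalues of `J_θ`, repeated by multiplicity, in increasing order. -/
def eigenvalue (J : JacobiMatrix) (q : ℕ) (j : Fin q) (θ : ℝ) : ℝ :=
  (J.floquet_isHermitian q θ).eigenvalues₀ (Fin.cast (Fintype.card_fin q).symm j.rev)

/-- The orthogonal projection `P_j(θ)` of `ℂ^q` onto `ker (J_θ - λ_j(θ))`. -/
def eigenprojection (J : JacobiMatrix) (q : ℕ) (j : Fin q) (θ : ℝ) :
    EuclideanSpace ℂ (Fin q) →L[ℂ] EuclideanSpace ℂ (Fin q) :=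
  (Module.End.eigenspace (Matrix.toEuclideanLin (J.floquet q θ))
    (J.eigenvalue q j θ : ℂ)).starProjection

/-- The fibre `Q_θ = q ∑ⱼ λ_j'(θ) P_j(θ)` of the asymptotic velocity operator. -/
def asymptoticVelocity (J : JacobiMatrix) (q : ℕ) (θ : ℝ) :
    EuclideanSpace ℂ (Fin q) →L[ℂ] EuclideanSpace ℂ (Fin q) :=
  (q : ℂ) • ∑ j : Fin q, ((deriv (J.eigenvalue q j) θ : ℝ) : ℂ) • J.eigenprojection q j θ

/-- The Heisenberg evolution `e^{i s J_θ} A_θ e^{-i s J_θ}` of the fibre `A_θ`. -/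
def heisenberg (J : JacobiMatrix) (q : ℕ) (θ s : ℝ) :
    EuclideanSpace ℂ (Fin q) →L[ℂ] EuclideanSpace ℂ (Fin q) :=
  NormedSpace.exp ((Complex.I * (s : ℂ)) • Matrix.toEuclideanCLM (𝕜 := ℂ) (J.floquet q θ))
    * Matrix.toEuclideanCLM (𝕜 := ℂ) (J.velocity q θ)
    * NormedSpace.exp
        (-((Complex.I * (s : ℂ)) • Matrix.toEuclideanCLM (𝕜 := ℂ) (J.floquet q θ)))

/-- The time average `t⁻¹ ∫₀ᵗ e^{i s J_θ} A_θ e^{-i s J_θ} ds`. -/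
def averagedVelocity (J : JacobiMatrix) (q : ℕ) (θ t : ℝ) :
    EuclideanSpace ℂ (Fin q) →L[ℂ] EuclideanSpace ℂ (Fin q) :=
  ((t⁻¹ : ℝ) : ℂ) • ∫ s in (0 : ℝ)..t, J.heisenberg q θ s

end JacobiMatrix

end

/-!
The corners of `J_θ` carry the only dependence on `θ`, so its characteristic polynomial is
`Δ - 2 (a₁ ⋯ a_q) cos θ` with a real polynomial `Δ`, the discriminant. All these polynomials are
real rooted, in particular for `cos θ = ±1`, and Laguerre's inequality then forces
`|Δ| ≥ 2 a₁ ⋯ a_q` at the critical points of `Δ`. A critical point lies between any two eigenvalues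
of `J_θ`, whence a gap of at least `sin² θ / C^q`.

With `X` the position inside a period cell, `A_θ = i [J_θ, X] + q ∂_θ J_θ`. In the eigenbasis of
`J_θ` the commutator has no diagonal, so by Hellmann–Feynman `Q_θ` is the diagonal of `A_θ`, which
the Heisenberg evolution preserves; the time average of an off-diagonal entry is damped by
`min(1, 2 / (t · gap)) ≤ (2 / (t · gap))^α` for every `α ∈ [0, 1]`. The square of this bound
contains `|sin θ|^{-4α}`, which is integrable precisely for `α < 1/4`.
-/

noncomputable section

section RealRooted

open Polynomial

variable {F : Type*} [Field F] [LinearOrder F] [IsStrictOrderedRing F]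

theorem eval_mul_eval_derivative_derivative_le_sq_of_splits {p : F[X]} (hp : p.Splits) (x : F) :
    p.eval x * (derivative (derivative p)).eval x ≤ (derivative p).eval x ^ 2 := by
  induction hp using Submonoid.closure_induction with
  | mem f hf => rcases hf with ⟨a, rfl⟩ | ⟨a, rfl⟩ <;> simp
  | one => simp
  | mul f g _ _ hf hg =>
    simp only [derivative_mul, derivative_add, eval_add, eval_mul]
    nlinarith [mul_le_mul_of_nonneg_left hf (sq_nonneg (g.eval x)),
      mul_le_mul_of_nonneg_left hg (sq_nonneg (f.eval x))]

/-- Laguerre's inequality. -/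
theorem eval_mul_eval_derivative_derivative_lt_sq_of_splits {p : F[X]} (hp : p.Splits)
    (hdeg : p.natDegree ≠ 0) {x : F} (hx : p.eval x ≠ 0) :
    p.eval x * (derivative (derivative p)).eval x < (derivative p).eval x ^ 2 := by
  obtain ⟨a, ha⟩ := hp.exists_eval_eq_zero (mt natDegree_eq_of_degree_eq_some hdeg)
  obtain ⟨g, rfl⟩ := dvd_iff_isRoot.2 ha
  have hg := eval_mul_eval_derivative_derivative_le_sq_of_splits
    (hp.of_dvd (ne_zero_of_natDegree_gt (Nat.pos_of_ne_zero hdeg)) (dvd_mul_left g _)) x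
  have hgx : g.eval x ≠ 0 := right_ne_zero_of_mul (eval_mul (R := F) ▸ hx)
  simp only [derivative_mul, derivative_add, derivative_sub, derivative_X, derivative_C, sub_zero,
    one_mul, eval_add, eval_mul, eval_sub, eval_X, eval_C]
  nlinarith [mul_le_mul_of_nonneg_left hg (sq_nonneg (x - a)), sq_pos_of_ne_zero hgx]

/-- Where `p' = 0` and `|p| < c`, Laguerre's inequality gives `p'' > 0` for `p - c` and `p'' < 0`
for `p + c`. -/
theorem le_abs_eval_of_splits_of_eval_derivative_eq_zero {p : F[X]} {c x : F}
    (hdeg : p.natDegree ≠ 0) (hsub : (p - C c).Splits) (hadd : (p + C c).Splits)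
    (hx : (derivative p).eval x = 0) : c ≤ |p.eval x| := by
  by_contra! hlt
  obtain ⟨habove, hbelow⟩ := abs_lt.1 hlt
  replace habove : 0 < p.eval x + c := neg_lt_iff_pos_add.1 habove
  replace hbelow : p.eval x - c < 0 := sub_neg.2 hbelow
  have hsub' := eval_mul_eval_derivative_derivative_lt_sq_of_splits hsub (x := x)
    (by rwa [natDegree_sub_C]) (by rw [eval_sub, eval_C]; exact hbelow.ne)
  have hadd' := eval_mul_eval_derivative_derivative_lt_sq_of_splits hadd (x := x)
    (by rwa [natDegree_add_C]) (by rw [eval_add, eval_C]; exact habove.ne')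
  simp only [derivative_sub, derivative_add, derivative_C, sub_zero, add_zero, eval_sub, eval_add,
    eval_C, hx, zero_pow two_ne_zero] at hsub' hadd'
  exact lt_asymm (pos_of_mul_neg_right hsub' hbelow.le)
    (neg_of_mul_neg_right (mul_comm (p.eval x + c) _ ▸ hadd') habove.le)

end RealRooted

section Determinant

open Matrix

variable {n A : Type*} [DecidableEq n] [CommRing A]

theorem add_single_eq_updateRow (M : Matrix n n A) (i j : n) (x : A) :
    M + single i j x = M.updateRow i (M i + x • Pi.single j 1) := by
  ext k l
  rcases eq_or_ne k i with rfl | hk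
  · simp [single_apply, Pi.single_apply, eq_comm]
  · simp [hk, hk.symm]

variable [Fintype n]

theorem det_add_single (M : Matrix n n A) (i j : n) (x : A) :
    (M + single i j x).det = M.det + x * M.adjugate j i := by
  rw [add_single_eq_updateRow, det_updateRow_add, updateRow_eq_self, det_updateRow_smul,
    adjugate_apply]

theorem exists_adjugate_add_single_apply (M : Matrix n n A) (i j k l : n) :
    ∃ c, ∀ x, (M + single i j x).adjugate l k = M.adjugate l k + x * c := by
  rcases eq_or_ne k i with rfl | hki
  · refine ⟨0, fun x => ?_⟩
    rw [adjugate_apply, add_single_eq_updateRow, updateRow_idem, ← adjugate_apply, mul_zero,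
      add_zero]
  · refine ⟨(M.updateRow k (Pi.single l 1)).adjugate j i, fun x => ?_⟩
    rw [adjugate_apply, adjugate_apply, ← det_add_single, add_single_eq_updateRow,
      add_single_eq_updateRow, updateRow_comm _ hki.symm, updateRow_ne hki.symm]

/-- A determinant is affine in each single entry. -/
theorem exists_det_add_single_add_single (M : Matrix n n A) (i j k l : n) :
    ∃ c, ∀ x y, (M + single i j x + single k l y).det
      = M.det + x * M.adjugate j i + y * M.adjugate l k + x * y * c := by
  obtain ⟨c, hc⟩ := exists_adjugate_add_single_apply M i j k l
  refine ⟨c, fun x y => ?_⟩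
  rw [det_add_single, det_add_single, hc]
  ring

theorem adjugate_last_zero_of_lower_zero {m : ℕ} {M : Matrix (Fin (m + 1)) (Fin (m + 1)) A}
    (h : ∀ i j : Fin (m + 1), (j : ℕ) + 1 < i → M i j = 0) :
    M.adjugate (Fin.last m) 0 = (-1) ^ m * ∏ i : Fin m, M i.succ i.castSucc := by
  rw [adjugate_fin_succ_eq_det_submatrix, Fin.succAbove_zero, Fin.succAbove_last,
    det_of_isUpperTriangular]
  · simp
  · intro i j hij
    exact h _ _ (by simpa only [Fin.val_succ, Fin.val_castSucc, id, Fin.lt_def,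
      Nat.add_lt_add_iff_right] using hij)

end Determinant

section OrderedRoots

open Filter Topology

variable {ι : Type*} [LinearOrder ι] [Finite ι]

theorem eq_of_strictMono_of_monotone_of_range_subset {α : Type*} [LinearOrder α] {f g : ι → α}
    (hf : StrictMono f) (hg : Monotone g) (h : range f ⊆ range g) : f = g := by
  choose k hk using fun i => h (mem_range_self i)
  have hkmono : StrictMono k := fun i j hij => hg.reflect_lt (by rw [hk, hk]; exact hf hij)
  ext i
  rw [← hk, hkmono.apply_eq]

/-- The implicit function theorem gives differentiable branches through the roots at `s₀`; by
ordering they are the nearby roots. -/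
theorem differentiableAt_of_ordered_simple_roots {f y : ℝ → ℝ} {f' : ι → ℝ} {r : ι → ℝ → ℝ}
    {s₀ : ℝ} (hf : ∀ i, HasStrictDerivAt f (f' i) (r i s₀))
    (hf' : ∀ i, f' i ≠ 0) (hy : DifferentiableAt ℝ y s₀) (hr : ∀ i, f (r i s₀) = y s₀)
    (hroots : ∀ s x, f x = y s → ∃ i, r i s = x) (hmono : ∀ s, Monotone fun i => r i s)
    (hstrict : StrictMono fun i => r i s₀) (i : ι) : DifferentiableAt ℝ (r i) s₀ := by
  set g : ι → ℝ → ℝ := fun k s => (hf k).localInverse f _ _ (hf' k) (y s)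
  have hg₀ : ∀ k, g k s₀ = r k s₀ := fun k => by
    simp only [g, ← hr k]
    exact ((hf k).eventually_left_inverse (hf' k)).self_of_nhds
  have hg : ∀ k, DifferentiableAt ℝ (g k) s₀ := fun k =>
    DifferentiableAt.comp s₀
      (hr k ▸ ((hf k).to_localInverse (hf' k)).hasDerivAt.differentiableAt) hy
  have hfg : ∀ k, ∀ᶠ s in 𝓝 s₀, f (g k s) = y s := fun k =>
    hy.continuousAt.eventually (hr k ▸ (hf k).eventually_right_inverse (hf' k))
  have hlt : ∀ k l, k < l → ∀ᶠ s in 𝓝 s₀, g k s < g l s := fun k l hkl =>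
    (hg k).continuousAt.eventually_lt (hg l).continuousAt (by rw [hg₀, hg₀]; exact hstrict hkl)
  have hgr : ∀ᶠ s in 𝓝 s₀, (fun k => r k s) = fun k => g k s := by
    filter_upwards [eventually_all.2 hfg, eventually_all.2 fun k => eventually_all.2 fun l =>
      eventually_all.2 (hlt k l)] with s hfgs hlts
    refine (eq_of_strictMono_of_monotone_of_range_subset (fun k l => hlts k l) (hmono s) ?_).symm
    rintro _ ⟨k, rfl⟩
    exact hroots s _ (hfgs k)
  exact (hg i).congr_of_eventuallyEq (hgr.mono fun s hs => congrFun hs i)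

end OrderedRoots

section EigenbasisCalculus

variable {ι E : Type*} [Fintype ι] [NormedAddCommGroup E] [InnerProductSpace ℂ E]

theorem hasDerivAt_complexCLM_apply {H : ℝ → E →L[ℂ] E} {H' : E →L[ℂ] E} {v : ℝ → E} {v' : E}
    {s₀ : ℝ} (hH : HasDerivAt H H' s₀) (hv : HasDerivAt v v' s₀) :
    HasDerivAt (fun s => H s (v s)) (H' (v s₀) + H s₀ v') s₀ :=
  ((ContinuousLinearMap.restrictScalarsL ℂ E E ℝ ℝ).hasFDerivAt.comp_hasDerivAt s₀ hH).clm_apply hv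

theorem inner_apply_of_apply_eq_smul (u : OrthonormalBasis ι ℂ E) {T : E →L[ℂ] E} {l : ι → ℂ}
    (hT : ∀ i, T (u i) = l i • u i) (k : ι) (x : E) :
    inner ℂ (u k) (T x) = l k * inner ℂ (u k) x := by
  classical
  conv_lhs => rw [← u.sum_repr x]
  simp only [map_sum, map_smul, hT, inner_sum, inner_smul_right,
    orthonormal_iff_ite.1 u.orthonormal, mul_ite, mul_one, mul_zero, Finset.sum_ite_eq,
    Finset.mem_univ, if_true, u.repr_apply_apply]
  ring

/-- The Hellmann–Feynman formula. -/
theorem mul_inner_eq_inner_of_hasDerivAt_eigen {H : ℝ → E →L[ℂ] E} {H' : E →L[ℂ] E} {l : ℝ → ℝ}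
    {l' s₀ : ℝ} {v : ℝ → E} {w : E} (hH : HasDerivAt H H' s₀) (hl : HasDerivAt l l' s₀)
    (hv : DifferentiableAt ℝ v s₀) (hHv : ∀ s, H s (v s) = (l s : ℂ) • v s)
    (hw : ∀ x, inner ℂ w (H s₀ x) = l s₀ * inner ℂ w x) :
    l' * inner ℂ w (v s₀) = inner ℂ w (H' (v s₀)) := by
  have hHv' := hasDerivAt_complexCLM_apply hH hv.hasDerivAt
  simp only [hHv] at hHv'
  have h := congrArg (inner ℂ w) (hHv'.unique (hl.ofReal_comp.smul hv.hasDerivAt))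
  rw [inner_add_right, inner_add_right, inner_smul_right, inner_smul_right, hw] at h
  linear_combination -h

/-- Near a simple eigenvalue, applying `∏_{k ≠ j} (H s - l k s)` to a fixed vector gives a
differentiable choice of eigenvector. -/
theorem exists_differentiableAt_inner_eq_prod {H : ℝ → E →L[ℂ] E} {l : ι → ℝ → ℝ} {s₀ : ℝ}
    (hH : DifferentiableAt ℝ H s₀) (hl : ∀ i, DifferentiableAt ℝ (l i) s₀)
    {u : ℝ → OrthonormalBasis ι ℂ E} (hu : ∀ s i, H s (u s i) = (l i s : ℂ) • u s i)
    (w : E) (S : Finset ι) :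
    ∃ v : ℝ → E, DifferentiableAt ℝ v s₀ ∧ ∀ s i,
      inner ℂ (u s i) (v s) = (∏ k ∈ S, ((l i s - l k s : ℝ) : ℂ)) * inner ℂ (u s i) w := by
  classical
  induction S using Finset.induction_on with
  | empty => exact ⟨fun _ => w, differentiableAt_const w, fun s i => by simp⟩
  | insert k S hk ih =>
    obtain ⟨v, hv, hvS⟩ := ih
    refine ⟨fun s => H s (v s) - (l k s : ℂ) • v s, ?_, fun s i => ?_⟩
    · exact (hasDerivAt_complexCLM_apply hH.hasDerivAt hv.hasDerivAt).differentiableAt.sub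
        ((hl k).hasDerivAt.ofReal_comp.differentiableAt.smul hv)
    · rw [inner_sub_right, inner_smul_right, inner_apply_of_apply_eq_smul _ (hu s), hvS,
        Finset.prod_insert hk]
      push_cast
      ring

theorem inner_deriv_apply_self_eq_deriv_eigenvalue {H : ℝ → E →L[ℂ] E} {H' : E →L[ℂ] E}
    {l : ι → ℝ → ℝ} {s₀ : ℝ} (hH : HasDerivAt H H' s₀) (hl : ∀ i, DifferentiableAt ℝ (l i) s₀)
    {u : ℝ → OrthonormalBasis ι ℂ E} (hu : ∀ s i, H s (u s i) = (l i s : ℂ) • u s i)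
    (hinj : Function.Injective fun i => l i s₀) (j : ι) :
    inner ℂ (u s₀ j) (H' (u s₀ j)) = (deriv (l j) s₀ : ℝ) := by
  classical
  obtain ⟨v, hv, huv⟩ := exists_differentiableAt_inner_eq_prod hH.differentiableAt hl hu (u s₀ j)
    (Finset.univ.erase j)
  have hHv : ∀ s, H s (v s) = (l j s : ℂ) • v s := fun s => by
    refine InnerProductSpace.ext_inner_left_basis (u s).toBasis fun i => ?_
    rw [OrthonormalBasis.coe_toBasis, inner_apply_of_apply_eq_smul _ (hu s), inner_smul_right]
    rcases eq_or_ne i j with rfl | hij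
    · rfl
    · rw [huv, Finset.prod_eq_zero (Finset.mem_erase.2 ⟨hij, Finset.mem_univ i⟩) (by simp)]
      simp
  have hv₀ : v s₀ = (∏ k ∈ Finset.univ.erase j, ((l j s₀ - l k s₀ : ℝ) : ℂ)) • u s₀ j := by
    refine InnerProductSpace.ext_inner_left_basis (u s₀).toBasis fun i => ?_
    rw [OrthonormalBasis.coe_toBasis, huv, inner_smul_right]
    rcases eq_or_ne i j with rfl | hij
    · rfl
    · rw [(u s₀).orthonormal.2 hij, mul_zero, mul_zero]
  have hprod : (∏ k ∈ Finset.univ.erase j, ((l j s₀ - l k s₀ : ℝ) : ℂ)) ≠ 0 :=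
    Finset.prod_ne_zero_iff.2 fun k hk => Complex.ofReal_ne_zero.2
      (sub_ne_zero.2 (hinj.ne (Finset.ne_of_mem_erase hk).symm))
  have h := mul_inner_eq_inner_of_hasDerivAt_eigen hH (hl j).hasDerivAt hv hHv
    (inner_apply_of_apply_eq_smul (u s₀) (hu s₀) j)
  rw [hv₀, map_smul, inner_smul_right, inner_smul_right, mul_left_comm,
    orthonormal_iff_ite.1 (u s₀).orthonormal, if_pos rfl, mul_one] at h
  exact (mul_left_cancel₀ hprod h).symm

end EigenbasisCalculus

section HeisenbergAverage

variable {ι E : Type*} [Fintype ι] [NormedAddCommGroup E] [InnerProductSpace ℂ E]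

theorem norm_le_sum_norm_inner (u : OrthonormalBasis ι ℂ E) (x : E) :
    ‖x‖ ≤ ∑ j, ‖inner ℂ (u j) x‖ := by
  conv_lhs => rw [← u.sum_repr' x]
  refine (norm_sum_le _ _).trans (Finset.sum_le_sum fun j _ => ?_)
  rw [norm_smul, u.orthonormal.1 j, mul_one]

theorem opNorm_le_sum_norm_inner (u : OrthonormalBasis ι ℂ E) (T : E →L[ℂ] E) :
    ‖T‖ ≤ ∑ k, ∑ j, ‖inner ℂ (u j) (T (u k))‖ := by
  refine T.opNorm_le_bound (by positivity) fun x => ?_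
  calc ‖T x‖ = ‖∑ k, inner ℂ (u k) x • T (u k)‖ := by
        conv_lhs => rw [← u.sum_repr' x]
        simp only [map_sum, map_smul]
    _ ≤ ∑ k, ‖x‖ * ∑ j, ‖inner ℂ (u j) (T (u k))‖ := by
        refine (norm_sum_le _ _).trans (Finset.sum_le_sum fun k _ => ?_)
        have hk : ‖inner ℂ (u k) x‖ ≤ ‖x‖ := by
          simpa only [u.orthonormal.1 k, one_mul] using norm_inner_le_norm (𝕜 := ℂ) (u k) x
        rw [norm_smul]
        gcongr
        exact norm_le_sum_norm_inner u _
    _ = _ := by rw [← Finset.mul_sum, mul_comm]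

theorem norm_average_exp_le {δ t α : ℝ} (hδ : δ ≠ 0) (ht : 0 < t) (hα : α ∈ Icc (0 : ℝ) 1) :
    ‖((t⁻¹ : ℝ) : ℂ) * ∫ s in (0 : ℝ)..t, Complex.exp (Complex.I * s * δ)‖
      ≤ (2 / (t * |δ|)) ^ α := by
  have hunit : ∀ s : ℝ, ‖Complex.exp (Complex.I * s * δ)‖ = 1 := fun s => by
    rw [mul_assoc, ← Complex.ofReal_mul, mul_comm, Complex.norm_exp_ofReal_mul_I]
  have hone : ‖((t⁻¹ : ℝ) : ℂ) * ∫ s in (0 : ℝ)..t, Complex.exp (Complex.I * s * δ)‖ ≤ 1 := by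
    rw [norm_mul, Complex.norm_real, Real.norm_of_nonneg (by positivity), inv_mul_le_iff₀ ht,
      mul_one]
    have h := intervalIntegral.norm_integral_le_of_norm_le_const (a := 0) (b := t)
      (fun s _ => (hunit s).le)
    rwa [one_mul, sub_zero, abs_of_pos ht] at h
  have hdecay : ‖((t⁻¹ : ℝ) : ℂ) * ∫ s in (0 : ℝ)..t, Complex.exp (Complex.I * s * δ)‖
      ≤ 2 / (t * |δ|) := by
    have hint : ∫ s in (0 : ℝ)..t, Complex.exp (Complex.I * s * δ)
        = (Complex.exp (Complex.I * t * δ) - 1) / (Complex.I * δ) := by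
      have h := integral_exp_mul_complex (a := 0) (b := t)
        (mul_ne_zero Complex.I_ne_zero (Complex.ofReal_ne_zero.2 hδ))
      simp only [Complex.ofReal_zero, mul_zero, Complex.exp_zero] at h
      simpa only [mul_right_comm] using h
    rw [hint, norm_mul, norm_div, norm_mul, Complex.norm_I, one_mul, Complex.norm_real,
      Complex.norm_real, Real.norm_of_nonneg (by positivity), Real.norm_eq_abs,
      show 2 / (t * |δ|) = t⁻¹ * (2 / |δ|) by field_simp]
    gcongr
    refine (norm_sub_le _ _).trans ?_
    rw [hunit, norm_one, one_add_one_eq_two]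
  calc _ ≤ _ := Real.self_le_rpow_of_le_one (norm_nonneg _) hone hα.2
    _ ≤ _ := Real.rpow_le_rpow (norm_nonneg _) hdecay hα.1

/-- The evolution `e^{isH} A e^{-isH}` of the observable `A` under the Hamiltonian `H`. -/
def heisenbergEvolution (H A : E →L[ℂ] E) (s : ℝ) : E →L[ℂ] E :=
  NormedSpace.exp ((Complex.I * (s : ℂ)) • H) * A
    * NormedSpace.exp (-((Complex.I * (s : ℂ)) • H))

/-- The average of the Heisenberg evolution over the times in `[0, t]`. -/
def heisenbergAverage (H A : E →L[ℂ] E) (t : ℝ) : E →L[ℂ] E :=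
  ((t⁻¹ : ℝ) : ℂ) • ∫ s in (0 : ℝ)..t, heisenbergEvolution H A s

variable [CompleteSpace E]

theorem exp_apply_of_apply_eq_smul {T : E →L[ℂ] E} {v : E} {z : ℂ} (h : T v = z • v) :
    NormedSpace.exp T v = Complex.exp z • v := by
  have hT := (NormedSpace.exp_series_hasSum_exp' (𝕂 := ℂ) T).mapL
    (ContinuousLinearMap.apply ℂ E v)
  have hz := (NormedSpace.exp_series_hasSum_exp' (𝕂 := ℂ) z).smul_const v
  have hpow : ∀ n : ℕ, (T ^ n) v = z ^ n • v := fun n => by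
    induction n with
    | zero => simp
    | succ n ih => rw [pow_succ', mul_apply_eq_comp, ih, map_smul, h, smul_smul, pow_succ]
  simp only [ContinuousLinearMap.apply_apply, smul_apply, hpow, ← smul_assoc] at hT
  rw [Complex.exp_eq_exp_ℂ]
  exact hT.unique hz

theorem continuous_heisenbergEvolution {X : Type*} [TopologicalSpace X] {H A : X → E →L[ℂ] E}
    (hH : Continuous H) (hA : Continuous A) :
    Continuous fun p : X × ℝ => heisenbergEvolution (H p.1) (A p.1) p.2 := by
  let _ : NormedAlgebra ℚ (E →L[ℂ] E) := NormedAlgebra.restrictScalars ℚ ℂ _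
  have hsH : Continuous fun p : X × ℝ => (Complex.I * (p.2 : ℂ)) • H p.1 := by fun_prop
  exact ((NormedSpace.exp_continuous.comp hsH).mul (hA.comp continuous_fst)).mul
    (NormedSpace.exp_continuous.comp hsH.neg)

theorem continuous_heisenbergAverage {H A : ℝ → E →L[ℂ] E} (hH : Continuous H)
    (hA : Continuous A) (t : ℝ) : Continuous fun θ => heisenbergAverage (H θ) (A θ) t := by
  have h := intervalIntegral.continuous_parametric_intervalIntegral_of_continuous'
    (μ := volume) (f := fun θ => heisenbergEvolution (H θ) (A θ))
    (continuous_heisenbergEvolution hH hA) 0 t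
  exact h.const_smul ((t⁻¹ : ℝ) : ℂ)

section Eigenbasis

variable {H : E →L[ℂ] E} {u : OrthonormalBasis ι ℂ E} {l : ι → ℝ}

theorem inner_heisenbergEvolution (hu : ∀ i, H (u i) = (l i : ℂ) • u i) (A : E →L[ℂ] E) (s : ℝ)
    (j k : ι) :
    inner ℂ (u j) (heisenbergEvolution H A s (u k))
      = Complex.exp (Complex.I * s * (l j - l k : ℝ)) * inner ℂ (u j) (A (u k)) := by
  have hexp : ∀ i, NormedSpace.exp ((Complex.I * (s : ℂ)) • H) (u i)
      = Complex.exp (Complex.I * s * l i) • u i := fun i =>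
    exp_apply_of_apply_eq_smul (by rw [smul_apply, hu, smul_smul])
  have hexp_neg : NormedSpace.exp (-((Complex.I * (s : ℂ)) • H)) (u k)
      = Complex.exp (-(Complex.I * s * l k)) • u k :=
    exp_apply_of_apply_eq_smul (by rw [neg_apply, smul_apply, hu, smul_smul, neg_smul])
  rw [heisenbergEvolution, mul_apply_eq_comp, mul_apply_eq_comp, hexp_neg,
    inner_apply_of_apply_eq_smul u hexp, map_smul, inner_smul_right, ← mul_assoc,
    ← Complex.exp_add]
  push_cast
  ring_nf

theorem inner_heisenbergAverage (hu : ∀ i, H (u i) = (l i : ℂ) • u i) (A : E →L[ℂ] E) (t : ℝ)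
    (j k : ι) :
    inner ℂ (u j) (heisenbergAverage H A t (u k))
      = (((t⁻¹ : ℝ) : ℂ) * ∫ s in (0 : ℝ)..t, Complex.exp (Complex.I * s * (l j - l k : ℝ)))
        * inner ℂ (u j) (A (u k)) := by
  have hcont : Continuous (heisenbergEvolution H A) :=
    (continuous_heisenbergEvolution (X := Unit) (H := fun _ => H) (A := fun _ => A)
      continuous_const continuous_const).comp (Continuous.prodMk_right ())
  have h := ((innerSL ℂ (u j)).comp
    (ContinuousLinearMap.apply ℂ _ (u k))).intervalIntegral_comp_comm
    (hcont.intervalIntegrable (μ := volume) 0 t)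
  simp only [ContinuousLinearMap.comp_apply, ContinuousLinearMap.apply_apply,
    innerSL_apply_apply, inner_heisenbergEvolution hu] at h
  rw [heisenbergAverage, smul_apply, inner_smul_right, ← h, intervalIntegral.integral_mul_const,
    mul_assoc]

/-- In the eigenbasis, averaging damps the off-diagonal entries of `A` and keeps the diagonal
ones. -/
theorem norm_sub_heisenbergAverage_le (hu : ∀ i, H (u i) = (l i : ℂ) • u i) {A D : E →L[ℂ] E}
    (hD : ∀ k, D (u k) = inner ℂ (u k) (A (u k)) • u k) {δ : ℝ} (hδ : 0 < δ)
    (hgap : ∀ j k, j ≠ k → δ ≤ |l j - l k|) {t α : ℝ} (ht : 0 < t) (hα : α ∈ Icc (0 : ℝ) 1) :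
    ‖D - heisenbergAverage H A t‖ ≤ (Fintype.card ι : ℝ) ^ 2 * ((2 / (t * δ)) ^ α * ‖A‖) := by
  classical
  have hentry : ∀ j k, ‖inner ℂ (u j) ((D - heisenbergAverage H A t) (u k))‖
      ≤ (2 / (t * δ)) ^ α * ‖A‖ := fun j k => by
    rw [sub_apply, inner_sub_right, hD, inner_smul_right, orthonormal_iff_ite.1 u.orthonormal,
      inner_heisenbergAverage hu]
    rcases eq_or_ne j k with rfl | hjk
    · have hdiag : ((t⁻¹ : ℝ) : ℂ) * ∫ s in (0 : ℝ)..t,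
          Complex.exp (Complex.I * s * (l j - l j : ℝ)) = 1 := by
        simp [ht.ne']
      rw [hdiag, if_pos rfl, mul_one, one_mul, sub_self, norm_zero]
      positivity
    · rw [if_neg hjk, mul_zero, zero_sub, norm_neg, norm_mul]
      have hjk' := hgap j k hjk
      have havg := norm_average_exp_le (abs_pos.1 (hδ.trans_le hjk')) ht hα
      have hA : ‖inner ℂ (u j) (A (u k))‖ ≤ ‖A‖ := by
        refine (norm_inner_le_norm _ _).trans ?_
        simpa only [u.orthonormal.1, one_mul, mul_one] using A.le_opNorm (u k)
      have hmono : (2 / (t * |l j - l k|)) ^ α ≤ (2 / (t * δ)) ^ α :=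
        Real.rpow_le_rpow (by positivity) (by gcongr) hα.1
      exact mul_le_mul (havg.trans hmono) hA (norm_nonneg _) (by positivity)
  refine (opNorm_le_sum_norm_inner u _).trans ((Finset.sum_le_sum fun k _ =>
    Finset.sum_le_sum fun j _ => hentry j k).trans_eq ?_)
  simp only [Finset.sum_const, Finset.card_univ, nsmul_eq_mul]
  ring

open Filter Topology in
theorem tendsto_heisenbergAverage (hu : ∀ i, H (u i) = (l i : ℂ) • u i) {A D : E →L[ℂ] E}
    (hD : ∀ k, D (u k) = inner ℂ (u k) (A (u k)) • u k) (hl : Function.Injective l) :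
    Tendsto (heisenbergAverage H A) atTop (𝓝 D) := by
  have hsmall : ∀ᶠ δ in 𝓝[>] (0 : ℝ), ∀ j k, j ≠ k → δ ≤ |l j - l k| :=
    eventually_all.2 fun j => eventually_all.2 fun k => eventually_imp_distrib_left.2 fun hjk =>
      nhdsWithin_le_nhds (Iic_mem_nhds (abs_pos.2 (sub_ne_zero.2 (hl.ne hjk))))
  obtain ⟨δ, hgap, hδ⟩ := (hsmall.and self_mem_nhdsWithin).exists
  have hδ₀ : 0 < δ := hδ
  have hzero : Tendsto (fun t : ℝ => (Fintype.card ι : ℝ) ^ 2 * (2 / (t * δ) * ‖A‖)) atTop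
      (𝓝 0) := by
    simpa only [id, zero_mul, mul_zero] using (((tendsto_id.atTop_mul_const hδ₀).const_div_atTop
      2).mul_const ‖A‖).const_mul ((Fintype.card ι : ℝ) ^ 2)
  rw [tendsto_iff_norm_sub_tendsto_zero]
  refine squeeze_zero' (Eventually.of_forall fun _ => norm_nonneg _) ?_ hzero
  filter_upwards [eventually_gt_atTop 0] with t ht
  rw [norm_sub_rev]
  simpa only [Real.rpow_one] using
    norm_sub_heisenbergAverage_le hu hD hδ₀ hgap ht (right_mem_Icc.2 zero_le_one)

end Eigenbasis

end HeisenbergAverage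

section SinIntegrals

open Real

theorem intervalIntegrable_abs_sin_rpow {r : ℝ} (hr : -1 < r) (a b : ℝ) :
    IntervalIntegrable (fun θ => |sin θ| ^ r) volume a b := by
  rcases le_or_gt 0 r with hr₀ | hr₀
  · exact (continuous_sin.abs.rpow_const fun _ => Or.inr hr₀).intervalIntegrable a b
  have hquarter : IntervalIntegrable (fun θ => |sin θ| ^ r) volume 0 (π / 2) := by
    have hpow := (intervalIntegral.intervalIntegrable_rpow' (a := 0) (b := π / 2) hr).const_mul
      ((2 / π) ^ r)
    refine hpow.mono_fun
      (by fun_prop : Measurable fun θ => |sin θ| ^ r).aestronglyMeasurable ?_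
    rw [uIoc_of_le (by positivity)]
    refine (ae_restrict_iff' measurableSet_Ioc).2 (Filter.Eventually.of_forall fun θ hθ => ?_)
    have hJordan := mul_le_sin hθ.1.le hθ.2
    have hθ₀ := hθ.1
    have hpos : 0 < 2 / π * θ := by positivity
    beta_reduce
    rw [norm_of_nonneg (by positivity), norm_of_nonneg (by positivity),
      abs_of_nonneg (hpos.le.trans hJordan), ← mul_rpow (by positivity) hθ₀.le]
    exact rpow_le_rpow_of_nonpos hpos hJordan hr₀.le
  have hhalf : IntervalIntegrable (fun θ => |sin θ| ^ r) volume 0 (0 + π) := by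
    have hreflect := (hquarter.comp_sub_left π).symm
    simp only [sin_pi_sub, sub_zero, sub_half] at hreflect
    exact (zero_add π).symm ▸ hquarter.trans hreflect
  have hperiodic : Function.Periodic (fun θ => |sin θ| ^ r) π := fun θ => by
    simp only [sin_add_pi, abs_neg]
  exact hperiodic.intervalIntegrable pi_ne_zero hhalf a b

theorem ae_sin_ne_zero : ∀ᵐ θ : ℝ, sin θ ≠ 0 := by
  have hzeros : {θ : ℝ | sin θ = 0}.Countable :=
    (countable_range fun n : ℤ => (n : ℝ) * π).mono fun _ hθ => sin_eq_zero_iff.1 hθ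
  exact hzeros.ae_notMem volume

theorem sin_ne_zero_of_mem_Ioo_of_ne_pi {θ : ℝ} (hθ : θ ∈ Ioo 0 (2 * π)) (hπ : θ ≠ π) :
    sin θ ≠ 0 := by
  rcases lt_or_gt_of_ne hπ with h | h
  · exact (sin_pos_of_pos_of_lt_pi hθ.1 h).ne'
  · have hpos := sin_pos_of_pos_of_lt_pi (x := θ - π) (by linarith) (by linarith [hθ.2])
    rw [sin_sub_pi] at hpos
    exact (neg_pos.1 hpos).ne

end SinIntegrals

section EntrywiseBounds

variable {n : Type*} [Fintype n] [DecidableEq n]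

theorem sum_ite_le_of_subsingleton {ι : Type*} (s : Finset ι) {p : ι → Prop} [DecidablePred p]
    (hp : {i | p i}.Subsingleton) {c : ℝ} (hc : 0 ≤ c) : ∑ i ∈ s, (if p i then c else 0) ≤ c := by
  rw [← Finset.sum_filter, Finset.sum_const, nsmul_eq_mul]
  have hcard : (s.filter p).card ≤ 1 := Finset.card_le_one.2 fun i hi j hj =>
    hp (Finset.mem_filter.1 hi).2 (Finset.mem_filter.1 hj).2
  exact mul_le_of_le_one_left hc (by exact_mod_cast hcard)

theorem norm_le_of_hasEigenvalue_of_sum_norm_le {K : Type*} [NormedField K] {M : Matrix n n K}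
    {z : K} (hz : Module.End.HasEigenvalue (Matrix.toLin' M) z) {c : ℝ}
    (hM : ∀ i, ∑ j, ‖M i j‖ ≤ c) : ‖z‖ ≤ c := by
  obtain ⟨k, hk⟩ := eigenvalue_mem_ball hz
  rw [mem_closedBall_iff_norm] at hk
  calc ‖z‖ ≤ ‖M k k‖ + ‖z - M k k‖ := by
        simpa only [add_sub_cancel] using norm_add_le (M k k) (z - M k k)
    _ ≤ ‖M k k‖ + ∑ j ∈ Finset.univ.erase k, ‖M k j‖ := by gcongr
    _ = ∑ j, ‖M k j‖ := Finset.add_sum_erase _ (fun j => ‖M k j‖) (Finset.mem_univ k)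
    _ ≤ c := hM k

theorem norm_toEuclideanCLM_le_of_norm_apply_le {M : Matrix n n ℂ} {c : ℝ}
    (hM : ∀ i j, ‖M i j‖ ≤ c) :
    ‖Matrix.toEuclideanCLM (𝕜 := ℂ) M‖ ≤ (Fintype.card n : ℝ) ^ 2 * c := by
  have hentry : ∀ i j, inner ℂ (EuclideanSpace.basisFun n ℂ i)
      (Matrix.toEuclideanCLM (𝕜 := ℂ) M (EuclideanSpace.basisFun n ℂ j)) = M i j := fun i j => by
    simp [EuclideanSpace.inner_single_left]
  refine (opNorm_le_sum_norm_inner (EuclideanSpace.basisFun n ℂ) _).trans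
    ((Finset.sum_le_sum fun j _ => Finset.sum_le_sum fun i _ =>
      ((congrArg norm (hentry i j)).trans_le (hM i j))).trans_eq ?_)
  simp only [Finset.sum_const, Finset.card_univ, nsmul_eq_mul]
  ring

end EntrywiseBounds

namespace JacobiMatrix

variable (J : JacobiMatrix) (q : ℕ)

/-- The product of the off-diagonal coefficients over the sites `1, …, q`. -/
def hopProd : ℝ := ∏ j : Fin q, J.a ((j : ℤ) + 1)

/-- The corner of the Floquet matrices that carries the factor `e^{-iθ}`. -/
def upperCorner : Matrix (Fin q) (Fin q) ℂ :=
  Matrix.of fun j k => if (j : ℕ) = 0 ∧ (k : ℕ) + 1 = q then (J.a q : ℂ) else 0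

/-- The corner of the Floquet matrices that carries the factor `e^{iθ}`. -/
def lowerCorner : Matrix (Fin q) (Fin q) ℂ :=
  Matrix.of fun j k => if (j : ℕ) + 1 = q ∧ (k : ℕ) = 0 then (J.a q : ℂ) else 0

/-- The tridiagonal part of the Floquet matrices, which does not depend on the quasimomentum. -/
def floquetBase : Matrix (Fin q) (Fin q) ℂ :=
  Matrix.of fun j k =>
    (if j = k then (J.b ((j : ℤ) + 1) : ℂ) else 0)
    + (if (k : ℕ) = j + 1 then (J.a ((j : ℤ) + 1) : ℂ) else 0)
    + (if (j : ℕ) = k + 1 then (J.a ((k : ℤ) + 1) : ℂ) else 0)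

/-- The part of the velocity that does not depend on the quasimomentum. -/
def velocityBase : Matrix (Fin q) (Fin q) ℂ :=
  Matrix.of fun j k =>
    (if (k : ℕ) = j + 1 then Complex.I * (J.a ((j : ℤ) + 1) : ℂ) else 0)
    + (if (j : ℕ) = k + 1 then -(Complex.I * (J.a ((k : ℤ) + 1) : ℂ)) else 0)

/-- The derivative of the Floquet matrix in the quasimomentum. -/
def floquetDeriv (θ : ℝ) : Matrix (Fin q) (Fin q) ℂ :=
  (-(Complex.I * Complex.exp (-(Complex.I * θ)))) • J.upperCorner q
    + (Complex.I * Complex.exp (Complex.I * θ)) • J.lowerCorner q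

/-- The Floquet matrix `J_θ` as an operator. -/
abbrev floquetOp (θ : ℝ) : EuclideanSpace ℂ (Fin q) →L[ℂ] EuclideanSpace ℂ (Fin q) :=
  Matrix.toEuclideanCLM (𝕜 := ℂ) (J.floquet q θ)

/-- The fibre `A_θ` of the velocity as an operator. -/
abbrev velocityOp (θ : ℝ) : EuclideanSpace ℂ (Fin q) →L[ℂ] EuclideanSpace ℂ (Fin q) :=
  Matrix.toEuclideanCLM (𝕜 := ℂ) (J.velocity q θ)

theorem floquet_eq (θ : ℝ) : J.floquet q θ = J.floquetBase q
    + Complex.exp (-(Complex.I * θ)) • J.upperCorner q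
    + Complex.exp (Complex.I * θ) • J.lowerCorner q := by
  ext j k
  simp only [floquet, floquetBase, upperCorner, lowerCorner, Matrix.of_apply, Matrix.add_apply,
    Matrix.smul_apply, smul_eq_mul, mul_ite, mul_zero]

theorem velocity_eq (θ : ℝ) : J.velocity q θ = J.velocityBase q + J.floquetDeriv q θ := by
  ext j k
  simp only [velocity, velocityBase, floquetDeriv, upperCorner, lowerCorner, Matrix.of_apply,
    Matrix.add_apply, Matrix.smul_apply, smul_eq_mul, mul_ite, mul_zero, neg_mul, add_assoc]

theorem hasDerivAt_floquetOp (θ : ℝ) :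
    HasDerivAt (J.floquetOp q) (Matrix.toEuclideanCLM (𝕜 := ℂ) (J.floquetDeriv q θ)) θ := by
  have hop : J.floquetOp q = fun θ : ℝ => Matrix.toEuclideanCLM (𝕜 := ℂ) (J.floquetBase q)
      + Complex.exp (-(Complex.I * θ)) • Matrix.toEuclideanCLM (𝕜 := ℂ) (J.upperCorner q)
      + Complex.exp (Complex.I * θ) • Matrix.toEuclideanCLM (𝕜 := ℂ) (J.lowerCorner q) := by
    funext θ
    rw [floquetOp, floquet_eq, map_add, map_add, map_smul, map_smul]
  have hphase : HasDerivAt (fun θ : ℝ => Complex.I * (θ : ℂ)) Complex.I θ := by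
    simpa using (Complex.ofRealCLM.hasDerivAt (x := θ)).const_mul Complex.I
  have hupper := hphase.neg.cexp.smul_const (Matrix.toEuclideanCLM (𝕜 := ℂ) (J.upperCorner q))
  have hlower := hphase.cexp.smul_const (Matrix.toEuclideanCLM (𝕜 := ℂ) (J.lowerCorner q))
  rw [hop]
  refine ((hupper.const_add (Matrix.toEuclideanCLM (𝕜 := ℂ) (J.floquetBase q))).add
    hlower).congr_deriv ?_
  rw [floquetDeriv, map_add, map_smul, map_smul]
  congr 2
  · simp only [Pi.neg_apply]
    ring
  · ring

theorem continuous_floquetOp : Continuous (J.floquetOp q) :=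
  continuous_iff_continuousAt.2 fun θ => (J.hasDerivAt_floquetOp q θ).continuousAt

theorem continuous_velocityOp : Continuous (J.velocityOp q) := by
  have hop : J.velocityOp q = fun θ : ℝ => Matrix.toEuclideanCLM (𝕜 := ℂ) (J.velocityBase q)
      + ((-(Complex.I * Complex.exp (-(Complex.I * θ)))) •
          Matrix.toEuclideanCLM (𝕜 := ℂ) (J.upperCorner q)
      + (Complex.I * Complex.exp (Complex.I * θ)) •
          Matrix.toEuclideanCLM (𝕜 := ℂ) (J.lowerCorner q)) := by
    funext θ
    rw [velocityOp, velocity_eq, floquetDeriv, map_add, map_add, map_smul, map_smul]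
  rw [hop]
  fun_prop

/-- The position operator inside a period cell. -/
def cellPosition : Matrix (Fin q) (Fin q) ℂ := Matrix.diagonal fun j => ((j : ℕ) : ℂ)

theorem upperCorner_commutator_cellPosition :
    J.upperCorner q * cellPosition q - cellPosition q * J.upperCorner q
      = ((q : ℂ) - 1) • J.upperCorner q := by
  ext j k
  simp only [upperCorner, cellPosition, Matrix.sub_apply, Matrix.mul_diagonal,
    Matrix.diagonal_mul, Matrix.smul_apply, Matrix.of_apply, smul_eq_mul]
  split_ifs with h
  · have hk : ((k : ℕ) : ℂ) = q - 1 := eq_sub_iff_add_eq.2 (by exact_mod_cast h.2)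
    rw [h.1, hk]
    push_cast
    ring
  · ring

theorem lowerCorner_commutator_cellPosition :
    J.lowerCorner q * cellPosition q - cellPosition q * J.lowerCorner q
      = (1 - (q : ℂ)) • J.lowerCorner q := by
  ext j k
  simp only [lowerCorner, cellPosition, Matrix.sub_apply, Matrix.mul_diagonal,
    Matrix.diagonal_mul, Matrix.smul_apply, Matrix.of_apply, smul_eq_mul]
  split_ifs with h
  · have hj : ((j : ℕ) : ℂ) = q - 1 := eq_sub_iff_add_eq.2 (by exact_mod_cast h.1)
    rw [h.2, hj]
    push_cast
    ring
  · ring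

theorem floquetBase_commutator_cellPosition :
    Complex.I • (J.floquetBase q * cellPosition q - cellPosition q * J.floquetBase q)
      = J.velocityBase q := by
  ext j k
  simp only [floquetBase, velocityBase, cellPosition, Matrix.sub_apply, Matrix.mul_diagonal,
    Matrix.diagonal_mul, Matrix.smul_apply, Matrix.of_apply, smul_eq_mul]
  rcases eq_or_ne j k with rfl | hjk
  · simp only [Nat.left_eq_add, one_ne_zero, if_false]
    ring
  by_cases hup : (k : ℕ) = j + 1
  · rw [if_neg hjk, if_pos hup, if_neg (by omega), if_pos hup, if_neg (by omega), hup]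
    push_cast
    ring
  by_cases hdown : (j : ℕ) = k + 1
  · rw [if_neg hjk, if_neg hup, if_pos hdown, if_neg hup, if_pos hdown, hdown]
    push_cast
    ring
  · rw [if_neg hjk, if_neg hup, if_neg hdown, if_neg hup, if_neg hdown]
    ring

/-- A step across the cell boundary changes the position in the cell by `±(q - 1)` instead of
`∓1`; the difference `±q` is the derivative in the quasimomentum. -/
theorem velocity_eq_commutator_add_floquetDeriv (θ : ℝ) : J.velocity q θ =
    Complex.I • (J.floquet q θ * cellPosition q - cellPosition q * J.floquet q θ)
      + (q : ℂ) • J.floquetDeriv q θ := by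
  rw [velocity_eq, floquet_eq, floquetDeriv, ← floquetBase_commutator_cellPosition]
  simp only [add_mul, mul_add, smul_mul_assoc, mul_smul_comm,
    sub_eq_iff_eq_add.1 (J.upperCorner_commutator_cellPosition q),
    sub_eq_iff_eq_add.1 (J.lowerCorner_commutator_cellPosition q)]
  module

end JacobiMatrix

namespace JacobiMatrix

variable (J : JacobiMatrix)

theorem transpose_floquetBase (q : ℕ) : (J.floquetBase q).transpose = J.floquetBase q := by
  ext j k
  rw [Matrix.transpose_apply, floquetBase, Matrix.of_apply, Matrix.of_apply]
  rcases eq_or_ne j k with rfl | hjk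
  · rfl
  · rw [if_neg hjk, if_neg hjk.symm]
    ring

theorem adjugate_scalar_sub_floquetBase_last_zero (n : ℕ) (z : ℂ) :
    (Matrix.scalar (Fin (n + 1)) z - J.floquetBase (n + 1)).adjugate (Fin.last n) 0
      = ∏ i : Fin n, (J.a ((i : ℤ) + 1) : ℂ) := by
  have hlower : ∀ i j : Fin (n + 1), (j : ℕ) + 1 < i →
      (Matrix.scalar (Fin (n + 1)) z - J.floquetBase (n + 1)) i j = 0 := fun i j hij => by
    have hne : i ≠ j := fun h => by rw [h] at hij; omega
    rw [Matrix.sub_apply, Matrix.scalar_apply, Matrix.diagonal_apply_ne _ hne, floquetBase,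
      Matrix.of_apply, if_neg hne, if_neg (by omega), if_neg (by omega)]
    ring
  have hsub : ∀ i : Fin n,
      (Matrix.scalar (Fin (n + 1)) z - J.floquetBase (n + 1)) i.succ i.castSucc
        = -1 * (J.a ((i : ℤ) + 1) : ℂ) := fun i => by
    have hne : i.succ ≠ i.castSucc := Fin.castSucc_lt_succ.ne'
    rw [Matrix.sub_apply, Matrix.scalar_apply, Matrix.diagonal_apply_ne _ hne, floquetBase,
      Matrix.of_apply, if_neg hne, Fin.val_succ, Fin.val_castSucc, if_neg (by omega), if_pos rfl]
    ring
  simp only [adjugate_last_zero_of_lower_zero hlower, hsub, Finset.prod_mul_distrib,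
    Finset.prod_const, Finset.card_univ, Fintype.card_fin]
  rw [← mul_assoc, ← mul_pow, neg_one_mul, neg_neg, one_pow, one_mul]

theorem adjugate_scalar_sub_floquetBase_zero_last (n : ℕ) (z : ℂ) :
    (Matrix.scalar (Fin (n + 1)) z - J.floquetBase (n + 1)).adjugate 0 (Fin.last n)
      = ∏ i : Fin n, (J.a ((i : ℤ) + 1) : ℂ) := by
  have hsymm : (Matrix.scalar (Fin (n + 1)) z - J.floquetBase (n + 1)).transpose
      = Matrix.scalar (Fin (n + 1)) z - J.floquetBase (n + 1) := by
    rw [Matrix.transpose_sub, transpose_floquetBase, Matrix.scalar_apply, Matrix.diagonal_transpose]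
  rw [← adjugate_scalar_sub_floquetBase_last_zero J n z]
  conv_rhs => rw [← hsymm, ← Matrix.adjugate_transpose, Matrix.transpose_apply]

theorem upperCorner_succ (n : ℕ) :
    J.upperCorner (n + 1) = Matrix.single 0 (Fin.last n) (J.a (n + 1 : ℕ) : ℂ) := by
  ext j k
  rw [upperCorner, Matrix.of_apply, Matrix.single_apply]
  exact if_congr (by simp only [Fin.ext_iff, Fin.val_zero, Fin.val_last]; omega) rfl rfl

theorem lowerCorner_succ (n : ℕ) :
    J.lowerCorner (n + 1) = Matrix.single (Fin.last n) 0 (J.a (n + 1 : ℕ) : ℂ) := by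
  ext j k
  rw [lowerCorner, Matrix.of_apply, Matrix.single_apply]
  exact if_congr (by simp only [Fin.ext_iff, Fin.val_zero, Fin.val_last]; omega) rfl rfl

theorem hopProd_succ (n : ℕ) : (J.hopProd (n + 1) : ℂ)
    = (∏ i : Fin n, (J.a ((i : ℤ) + 1) : ℂ)) * (J.a (n + 1 : ℕ) : ℂ) := by
  rw [hopProd, Fin.prod_univ_castSucc]
  push_cast
  rfl

/-- The determinant is affine in each of the two corners, and in their product the factors
`e^{±iθ}` cancel. -/
theorem exists_det_scalar_sub_floquet {q : ℕ} (hq : 0 < q) : ∃ D : ℂ → ℂ, ∀ (z : ℂ) (θ : ℝ),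
    (Matrix.scalar (Fin q) z - J.floquet q θ).det
      = D z - 2 * (J.hopProd q : ℂ) * (Real.cos θ : ℂ) := by
  obtain ⟨n, rfl⟩ := Nat.exists_eq_add_of_lt hq
  rw [zero_add]
  choose c hc using fun z => exists_det_add_single_add_single
    (Matrix.scalar (Fin (n + 1)) z - J.floquetBase (n + 1)) 0 (Fin.last n) (Fin.last n) 0
  refine ⟨fun z => (Matrix.scalar (Fin (n + 1)) z - J.floquetBase (n + 1)).det
    + (J.a (n + 1 : ℕ) : ℂ) ^ 2 * c z, fun z θ => ?_⟩
  have hcos : 2 * (Real.cos θ : ℂ)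
      = Complex.exp (Complex.I * θ) + Complex.exp (-(Complex.I * θ)) := by
    rw [Complex.ofReal_cos, Complex.two_cos, mul_comm (θ : ℂ), neg_mul, mul_comm (θ : ℂ)]
  have hexp : Complex.exp (Complex.I * θ) * Complex.exp (-(Complex.I * θ)) = 1 := by
    rw [← Complex.exp_add, add_neg_cancel, Complex.exp_zero]
  have hsplit : Matrix.scalar (Fin (n + 1)) z - J.floquet (n + 1) θ
      = Matrix.scalar (Fin (n + 1)) z - J.floquetBase (n + 1)
        + Matrix.single 0 (Fin.last n)
          (-(Complex.exp (-(Complex.I * θ)) * (J.a (n + 1 : ℕ) : ℂ)))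
        + Matrix.single (Fin.last n) 0
          (-(Complex.exp (Complex.I * θ) * (J.a (n + 1 : ℕ) : ℂ))) := by
    rw [floquet_eq, upperCorner_succ, lowerCorner_succ, Matrix.smul_single, Matrix.smul_single,
      ← Matrix.single_neg, ← Matrix.single_neg]
    simp only [smul_eq_mul]
    abel
  rw [hsplit, hc, adjugate_scalar_sub_floquetBase_last_zero,
    adjugate_scalar_sub_floquetBase_zero_last, hopProd_succ]
  linear_combination ((∏ i : Fin n, (J.a ((i : ℤ) + 1) : ℂ)) * J.a (n + 1 : ℕ)) * hcos
    + (J.a (n + 1 : ℕ) : ℂ) ^ 2 * c z * hexp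

end JacobiMatrix

namespace JacobiMatrix

open Polynomial

variable (J : JacobiMatrix)

theorem a_positive (n : ℤ) : 0 < J.a n :=
  let ⟨_, hc, h⟩ := J.a_pos
  hc.trans_le (h n)

theorem hopProd_pos (q : ℕ) : 0 < J.hopProd q := Finset.prod_pos fun _ _ => J.a_positive _

/-- Mathlib enumerates the eigenvalues of a Hermitian matrix decreasingly, through an equivalence
of its index type with `Fin`; this turns the increasing enumeration into Mathlib's. -/
def eigenIndex (q : ℕ) : Fin q ≃ Fin q :=
  Fin.revPerm.trans ((finCongr (Fintype.card_fin q).symm).trans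
    (Fintype.equivOfCardEq (Fintype.card_fin _)))

theorem eigenvalue_eq (q : ℕ) (j : Fin q) (θ : ℝ) :
    J.eigenvalue q j θ = (J.floquet_isHermitian q θ).eigenvalues (eigenIndex q j) := by
  simp [eigenvalue, Matrix.IsHermitian.eigenvalues, eigenIndex]

theorem eigenvalue_monotone (q : ℕ) (θ : ℝ) : Monotone fun j => J.eigenvalue q j θ :=
  fun _ _ hij => (J.floquet_isHermitian q θ).eigenvalues₀_antitone (Fin.rev_le_rev.2 hij)

/-- An orthonormal basis of eigenvectors of the Floquet matrix, in increasing order of the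
eigenvalues. -/
def eigenbasis (q : ℕ) (θ : ℝ) : OrthonormalBasis (Fin q) ℂ (EuclideanSpace ℂ (Fin q)) :=
  (J.floquet_isHermitian q θ).eigenvectorBasis.reindex (eigenIndex q).symm

theorem floquetOp_eigenbasis (q : ℕ) (θ : ℝ) (j : Fin q) :
    J.floquetOp q θ (J.eigenbasis q θ j)
      = (J.eigenvalue q j θ : ℂ) • J.eigenbasis q θ j := by
  have hvec := (J.floquet_isHermitian q θ).mulVec_eigenvectorBasis (eigenIndex q j)
  rw [← J.eigenvalue_eq] at hvec
  apply WithLp.ofLp_injective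
  rw [Matrix.ofLp_toEuclideanCLM, eigenbasis, OrthonormalBasis.reindex_apply, Equiv.symm_symm,
    hvec, WithLp.ofLp_smul]
  rfl

theorem hasEigenvalue_eigenvalue (q : ℕ) (j : Fin q) (θ : ℝ) :
    Module.End.HasEigenvalue (Matrix.toLin' (J.floquet q θ)) (J.eigenvalue q j θ : ℂ) := by
  refine Module.End.hasEigenvalue_of_hasEigenvector (x := ⇑(J.eigenbasis q θ j))
    ⟨Module.End.mem_eigenspace_iff.2 ?_, fun h => ?_⟩
  · rw [Matrix.toLin'_apply, ← Matrix.ofLp_toEuclideanCLM]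
    exact congrArg WithLp.ofLp (J.floquetOp_eigenbasis q θ j)
  · exact (J.eigenbasis q θ).orthonormal.ne_zero j (WithLp.ofLp_injective 2 h)

/-- The characteristic polynomial of the Floquet matrix, with its real roots made explicit. -/
def bandPoly (q : ℕ) (θ : ℝ) : ℝ[X] := ∏ j : Fin q, (X - C (J.eigenvalue q j θ))

theorem splits_bandPoly (q : ℕ) (θ : ℝ) : (J.bandPoly q θ).Splits :=
  Splits.prod fun _ _ => Splits.X_sub_C _

theorem natDegree_bandPoly (q : ℕ) (θ : ℝ) : (J.bandPoly q θ).natDegree = q := by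
  rw [bandPoly, natDegree_finsetProd_X_sub_C_eq_card, Finset.card_univ, Fintype.card_fin]

theorem eval_bandPoly (q : ℕ) (θ x : ℝ) :
    (J.bandPoly q θ).eval x = ∏ j : Fin q, (x - J.eigenvalue q j θ) := by
  simp only [bandPoly, eval_prod, eval_sub, eval_X, eval_C]

theorem eval_bandPoly_eq_det (q : ℕ) (θ x : ℝ) : (((J.bandPoly q θ).eval x : ℝ) : ℂ)
    = (Matrix.scalar (Fin q) (x : ℂ) - J.floquet q θ).det := by
  rw [← Matrix.eval_charpoly, (J.floquet_isHermitian q θ).charpoly_eq, eval_bandPoly, eval_prod,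
    Complex.ofReal_prod,
    ← (eigenIndex q).prod_comp fun i => eval (x : ℂ) _]
  refine Finset.prod_congr rfl fun j _ => ?_
  rw [eval_sub, eval_X, eval_C, ← eigenvalue_eq, Complex.ofReal_sub]
  rfl

/-- The discriminant of the period cell, the part of the characteristic polynomials of the Floquet
matrices that does not depend on `θ`; at `θ = π/2` it is all of it. -/
def discriminant (q : ℕ) : ℝ[X] := J.bandPoly q (Real.pi / 2)

variable {q : ℕ}

theorem bandPoly_eq (hq : 0 < q) (θ : ℝ) :
    J.bandPoly q θ = J.discriminant q - C (2 * J.hopProd q * Real.cos θ) := by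
  obtain ⟨D, hD⟩ := J.exists_det_scalar_sub_floquet hq
  refine Polynomial.funext fun x => Complex.ofReal_injective ?_
  rw [discriminant, eval_sub, eval_C, Complex.ofReal_sub, eval_bandPoly_eq_det,
    eval_bandPoly_eq_det, hD, hD, Real.cos_pi_div_two]
  push_cast
  ring

theorem derivative_bandPoly (hq : 0 < q) (θ : ℝ) :
    derivative (J.bandPoly q θ) = derivative (J.discriminant q) := by
  rw [bandPoly_eq J hq, derivative_sub, derivative_C, sub_zero]

theorem eval_bandPoly_eq_zero_iff {θ x : ℝ} :
    (J.bandPoly q θ).eval x = 0 ↔ ∃ j, J.eigenvalue q j θ = x := by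
  simp only [eval_bandPoly, Finset.prod_eq_zero_iff, Finset.mem_univ, true_and, sub_eq_zero,
    eq_comm (a := x)]

theorem eval_discriminant_eq_iff (hq : 0 < q) {θ x : ℝ} :
    (J.discriminant q).eval x = 2 * J.hopProd q * Real.cos θ ↔ ∃ j, J.eigenvalue q j θ = x := by
  rw [← eval_bandPoly_eq_zero_iff, J.bandPoly_eq hq, eval_sub, eval_C, sub_eq_zero]

theorem le_abs_eval_discriminant (hq : 0 < q) {x : ℝ}
    (hx : (derivative (J.discriminant q)).eval x = 0) :
    2 * J.hopProd q ≤ |(J.discriminant q).eval x| := by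
  refine le_abs_eval_of_splits_of_eval_derivative_eq_zero ?_ ?_ ?_ hx
  · rw [discriminant, natDegree_bandPoly]
    exact hq.ne'
  · simpa only [J.bandPoly_eq hq, Real.cos_zero, mul_one] using J.splits_bandPoly q 0
  · simpa only [J.bandPoly_eq hq, Real.cos_pi, mul_neg_one, C_neg, sub_neg_eq_add]
      using J.splits_bandPoly q Real.pi

theorem hopProd_mul_sin_sq_le_abs_eval_bandPoly (hq : 0 < q) (θ : ℝ) {x : ℝ}
    (hx : (derivative (J.discriminant q)).eval x = 0) :
    J.hopProd q * Real.sin θ ^ 2 ≤ |(J.bandPoly q θ).eval x| := by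
  have hpos := J.hopProd_pos q
  have hsin : Real.sin θ ^ 2 ≤ 2 - 2 * |Real.cos θ| := by
    nlinarith [Real.sin_sq_add_cos_sq θ, sq_abs (Real.cos θ), sq_nonneg (1 - |Real.cos θ|)]
  calc J.hopProd q * Real.sin θ ^ 2 ≤ J.hopProd q * (2 - 2 * |Real.cos θ|) := by gcongr
    _ = 2 * J.hopProd q - |2 * J.hopProd q * Real.cos θ| := by
        rw [abs_mul (2 * J.hopProd q), abs_of_pos (by positivity : 0 < 2 * J.hopProd q)]
        ring
    _ ≤ |(J.discriminant q).eval x| - |2 * J.hopProd q * Real.cos θ| := by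
        gcongr
        exact J.le_abs_eval_discriminant hq hx
    _ ≤ |(J.bandPoly q θ).eval x| := by
        rw [J.bandPoly_eq hq, eval_sub, eval_C]
        exact abs_sub_abs_le_abs_sub _ _

theorem eval_derivative_discriminant_ne_zero {θ : ℝ} (hθ : Real.sin θ ≠ 0) (j : Fin q) :
    (derivative (J.discriminant q)).eval (J.eigenvalue q j θ) ≠ 0 := fun h => by
  have hle := J.hopProd_mul_sin_sq_le_abs_eval_bandPoly j.pos θ h
  rw [J.eval_bandPoly_eq_zero_iff.2 ⟨j, rfl⟩, abs_zero] at hle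
  have hpos := J.hopProd_pos q
  exact hle.not_gt (by positivity)

theorem eigenvalue_strictMono {θ : ℝ} (hθ : Real.sin θ ≠ 0) :
    StrictMono fun j => J.eigenvalue q j θ := by
  refine (J.eigenvalue_monotone q θ).strictMono_of_injective fun j k hjk => ?_
  by_contra hne
  have hdvd : (X - C (J.eigenvalue q j θ)) ^ 2 ∣ J.bandPoly q θ := by
    rw [bandPoly, ← Finset.mul_prod_erase _ _ (Finset.mem_univ j), sq]
    refine mul_dvd_mul_left _ ?_
    rw [show J.eigenvalue q j θ = J.eigenvalue q k θ from hjk]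
    exact Finset.dvd_prod_of_mem _ (Finset.mem_erase.2 ⟨Ne.symm hne, Finset.mem_univ k⟩)
  obtain ⟨p, hp⟩ := hdvd
  refine J.eval_derivative_discriminant_ne_zero hθ j ?_
  rw [← J.derivative_bandPoly j.pos θ, hp]
  simp [derivative_pow]

theorem differentiableAt_eigenvalue {θ : ℝ} (hθ : Real.sin θ ≠ 0) (j : Fin q) :
    DifferentiableAt ℝ (J.eigenvalue q j) θ := by
  have hq := j.pos
  exact differentiableAt_of_ordered_simple_roots
    (fun i => (J.discriminant q).hasStrictDerivAt (J.eigenvalue q i θ))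
    (J.eval_derivative_discriminant_ne_zero hθ)
    (y := fun s => 2 * J.hopProd q * Real.cos s) (by fun_prop)
    (fun i => (J.eval_discriminant_eq_iff hq).2 ⟨i, rfl⟩)
    (fun _ _ h => (J.eval_discriminant_eq_iff hq).1 h)
    (J.eigenvalue_monotone q) (J.eigenvalue_strictMono hθ) j

theorem abs_eval_bandPoly_le {θ c x : ℝ} (hc : ∀ i, |J.eigenvalue q i θ| ≤ c) (hc₁ : 1 ≤ 2 * c)
    {j k : Fin q} (hx : x ∈ Icc (J.eigenvalue q j θ) (J.eigenvalue q k θ)) :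
    |(J.bandPoly q θ).eval x|
      ≤ (2 * c) ^ q * (J.eigenvalue q k θ - J.eigenvalue q j θ) := by
  have hfactor : ∀ i, |x - J.eigenvalue q i θ| ≤ 2 * c := fun i => by
    have hi := abs_le.1 (hc i)
    exact abs_le.2 ⟨by linarith [hx.1, (abs_le.1 (hc j)).1],
      by linarith [hx.2, (abs_le.1 (hc k)).2]⟩
  rw [eval_bandPoly, Finset.abs_prod, ← Finset.prod_erase_mul _ _ (Finset.mem_univ j)]
  have herase : ∏ i ∈ Finset.univ.erase j, |x - J.eigenvalue q i θ| ≤ (2 * c) ^ q := by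
    refine (Finset.prod_le_prod (fun _ _ => abs_nonneg _) fun i _ => hfactor i).trans ?_
    rw [Finset.prod_const]
    refine pow_le_pow_right₀ hc₁ ?_
    exact (Finset.card_le_univ _).trans_eq (Fintype.card_fin q)
  have hj : |x - J.eigenvalue q j θ| ≤ J.eigenvalue q k θ - J.eigenvalue q j θ := by
    rw [abs_of_nonneg (sub_nonneg.2 hx.1)]
    exact sub_le_sub_right hx.2 _
  exact mul_le_mul herase hj (abs_nonneg _) (by positivity)

/-- Between two eigenvalues the discriminant has a critical point, where by Laguerre's inequality
its absolute value is at least `2 * hopProd`; so the characteristic polynomial is large there. -/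
theorem hopProd_mul_sin_sq_le_mul_gap {θ c : ℝ} (hc : ∀ i, |J.eigenvalue q i θ| ≤ c)
    (hc₁ : 1 ≤ 2 * c) {j k : Fin q} (hjk : j ≠ k) : J.hopProd q * Real.sin θ ^ 2
      ≤ (2 * c) ^ q * |J.eigenvalue q j θ - J.eigenvalue q k θ| := by
  wlog hlt : j < k generalizing j k with hwlog
  · rw [abs_sub_comm]
    exact hwlog hjk.symm (hjk.lt_or_gt.resolve_left hlt)
  rw [abs_sub_comm, abs_of_nonneg (sub_nonneg.2 (J.eigenvalue_monotone q θ hlt.le))]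
  rcases eq_or_ne (Real.sin θ) 0 with hθ | hθ
  · rw [hθ]
    have hgap := sub_nonneg.2 (J.eigenvalue_monotone q θ hlt.le)
    simp only [ne_eq, OfNat.ofNat_ne_zero, not_false_eq_true, zero_pow, mul_zero]
    exact mul_nonneg (by positivity) hgap
  obtain ⟨x, hx, hcrit⟩ := exists_deriv_eq_zero (J.eigenvalue_strictMono hθ hlt)
    (J.bandPoly q θ).continuousOn
    ((J.eval_bandPoly_eq_zero_iff.2 ⟨j, rfl⟩).trans (J.eval_bandPoly_eq_zero_iff.2 ⟨k, rfl⟩).symm)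
  rw [Polynomial.deriv, J.derivative_bandPoly j.pos] at hcrit
  exact (J.hopProd_mul_sin_sq_le_abs_eval_bandPoly j.pos θ hcrit).trans
    (J.abs_eval_bandPoly_le hc hc₁ (Ioo_subset_Icc_self hx))

end JacobiMatrix

namespace JacobiMatrix

variable (J : JacobiMatrix) {q : ℕ} {θ : ℝ}

/-- The commutator with the position in the cell has zero diagonal in the eigenbasis, and by
Hellmann–Feynman the derivative of the Floquet matrix has the diagonal `λ_k'`. -/
theorem inner_velocityOp_eigenbasis (hθ : Real.sin θ ≠ 0) (k : Fin q) :
    inner ℂ (J.eigenbasis q θ k) (J.velocityOp q θ (J.eigenbasis q θ k))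
      = (q : ℂ) * (deriv (J.eigenvalue q k) θ : ℝ) := by
  have hderiv := inner_deriv_apply_self_eq_deriv_eigenvalue (J.hasDerivAt_floquetOp q θ)
    (J.differentiableAt_eigenvalue hθ) (J.floquetOp_eigenbasis q)
    (J.eigenvalue_strictMono hθ).injective k
  have hop : J.velocityOp q θ = Complex.I • (J.floquetOp q θ *
        Matrix.toEuclideanCLM (𝕜 := ℂ) (cellPosition q)
      - Matrix.toEuclideanCLM (𝕜 := ℂ) (cellPosition q) * J.floquetOp q θ)
      + (q : ℂ) • Matrix.toEuclideanCLM (𝕜 := ℂ) (J.floquetDeriv q θ) := by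
    rw [velocityOp, velocity_eq_commutator_add_floquetDeriv, map_add, map_smul, map_smul, map_sub,
      map_mul, map_mul]
  rw [hop, add_apply, smul_apply, smul_apply, sub_apply, mul_apply_eq_comp, mul_apply_eq_comp,
    floquetOp_eigenbasis, map_smul, inner_add_right, inner_smul_right, inner_smul_right,
    inner_sub_right, inner_apply_of_apply_eq_smul _ (J.floquetOp_eigenbasis q θ), inner_smul_right,
    sub_self, mul_zero, zero_add, hderiv]

theorem eigenprojection_eigenbasis (hθ : Real.sin θ ≠ 0) (j k : Fin q) :
    J.eigenprojection q j θ (J.eigenbasis q θ k)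
      = if j = k then J.eigenbasis q θ k else 0 := by
  have hmem : ∀ i, J.eigenbasis q θ i ∈ Module.End.eigenspace
      (Matrix.toEuclideanLin (J.floquet q θ)) (J.eigenvalue q i θ : ℂ) := fun i =>
    Module.End.mem_eigenspace_iff.2 (J.floquetOp_eigenbasis q θ i)
  rw [eigenprojection]
  rcases eq_or_ne j k with rfl | hjk
  · rw [if_pos rfl, Submodule.starProjection_eq_self_iff]
    exact hmem j
  · rw [if_neg hjk, Submodule.starProjection_apply_eq_zero_iff, Submodule.mem_orthogonal']
    intro v hv
    have heig : J.floquetOp q θ v = (J.eigenvalue q j θ : ℂ) • v :=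
      Module.End.mem_eigenspace_iff.1 hv
    have hinner := inner_apply_of_apply_eq_smul _ (J.floquetOp_eigenbasis q θ) k v
    rw [heig, inner_smul_right] at hinner
    refine (mul_eq_mul_right_iff.1 hinner).resolve_left fun h => hjk ?_
    exact (J.eigenvalue_strictMono hθ).injective (Complex.ofReal_injective h)

theorem asymptoticVelocity_eigenbasis (hθ : Real.sin θ ≠ 0) (k : Fin q) :
    J.asymptoticVelocity q θ (J.eigenbasis q θ k)
      = inner ℂ (J.eigenbasis q θ k) (J.velocityOp q θ (J.eigenbasis q θ k))
        • J.eigenbasis q θ k := by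
  simp only [inner_velocityOp_eigenbasis J hθ, asymptoticVelocity, smul_apply, sum_apply,
    eigenprojection_eigenbasis J hθ, smul_ite, smul_zero, Finset.sum_ite_eq', Finset.mem_univ,
    if_true, smul_smul]

theorem continuous_averagedVelocity (q : ℕ) (t : ℝ) :
    Continuous fun θ => J.averagedVelocity q θ t :=
  continuous_heisenbergAverage (J.continuous_floquetOp q) (J.continuous_velocityOp q) t

open Filter in
theorem aestronglyMeasurable_asymptoticVelocity (q : ℕ) :
    AEStronglyMeasurable (J.asymptoticVelocity q) volume :=
  aestronglyMeasurable_of_tendsto_ae atTop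
    (fun n : ℕ => (J.continuous_averagedVelocity q n).aestronglyMeasurable)
    (ae_sin_ne_zero.mono fun _ hθ => (tendsto_heisenbergAverage (J.floquetOp_eigenbasis q _)
      (J.asymptoticVelocity_eigenbasis hθ) (J.eigenvalue_strictMono hθ).injective).comp
        tendsto_natCast_atTop_atTop)

end JacobiMatrix

namespace JacobiMatrix

theorem norm_op_single_apply_le (J : JacobiMatrix) (m n : ℤ) :
    ‖J.op (lp.single (E := fun _ : ℤ => ℂ) 2 m 1) n‖ ≤ ‖J.op‖ :=
  (lp.norm_apply_le_norm two_ne_zero _ _).trans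
    (J.op.unit_le_opNorm _ (by rw [lp.norm_single two_pos, norm_one]))

theorem abs_b_le_norm_op (J : JacobiMatrix) (n : ℤ) : |J.b n| ≤ ‖J.op‖ := by
  have h := J.norm_op_single_apply_le n n
  rw [op_apply, lp.single_apply_self, lp.single_apply_ne _ _ _ (by omega),
    lp.single_apply_ne _ _ _ (by omega)] at h
  simpa using h

theorem a_le_norm_op (J : JacobiMatrix) (n : ℤ) : J.a n ≤ ‖J.op‖ := by
  have h := J.norm_op_single_apply_le (n + 1) n
  rw [op_apply, lp.single_apply_self, lp.single_apply_ne _ _ _ (by omega),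
    lp.single_apply_ne _ _ _ (by omega)] at h
  simpa [abs_of_pos (J.a_positive n)] using h

/-- The bounds that membership in the class of parameter `R` puts on the coefficients at the sites
`1, …, q`; the Floquet matrices of size `q` involve no others. -/
structure CoeffBound (J : JacobiMatrix) (q : ℕ) (R : ℝ) : Prop where
  abs_b_le : ∀ n ∈ Icc (1 : ℤ) q, |J.b n| ≤ R
  a_le : ∀ n ∈ Icc (1 : ℤ) q, J.a n ≤ R
  inv_le_a : ∀ n ∈ Icc (1 : ℤ) q, R⁻¹ ≤ J.a n

theorem coeffBound_of_mem_boundedClass {J : JacobiMatrix} {R : ℝ} (hJ : J ∈ boundedClass R)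
    (q : ℕ) : J.CoeffBound q R where
  abs_b_le n _ := (J.abs_b_le_norm_op n).trans hJ.1
  a_le n _ := (J.a_le_norm_op n).trans hJ.1
  inv_le_a n _ := hJ.2 n

namespace CoeffBound

variable {J : JacobiMatrix} {q : ℕ} {R : ℝ}

theorem one_le (h : J.CoeffBound q R) (hq : 0 < q) : 1 ≤ R := by
  have hmem : (1 : ℤ) ∈ Icc (1 : ℤ) q := ⟨le_rfl, by exact_mod_cast hq⟩
  have hR : 0 < R := (J.a_positive 1).trans_le (h.a_le 1 hmem)
  have hinv := (h.inv_le_a 1 hmem).trans (h.a_le 1 hmem)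
  rw [inv_le_iff_one_le_mul₀ hR] at hinv
  nlinarith

theorem abs_b_add_one_le (h : J.CoeffBound q R) (j : Fin q) : |J.b ((j : ℤ) + 1)| ≤ R :=
  h.abs_b_le _ ⟨by omega, by omega⟩

theorem abs_a_add_one_le (h : J.CoeffBound q R) (j : Fin q) : |J.a ((j : ℤ) + 1)| ≤ R := by
  rw [abs_of_pos (J.a_positive _)]
  exact h.a_le _ ⟨by omega, by omega⟩

theorem abs_a_last_le (h : J.CoeffBound q R) (hq : 0 < q) : |J.a q| ≤ R := by
  rw [abs_of_pos (J.a_positive _)]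
  exact h.a_le _ ⟨by omega, le_rfl⟩

theorem inv_pow_le_hopProd (h : J.CoeffBound q R) (hR : 0 ≤ R) : R⁻¹ ^ q ≤ J.hopProd q := by
  have hprod := Finset.prod_le_prod (s := Finset.univ) (f := fun _ : Fin q => R⁻¹)
    (g := fun j : Fin q => J.a ((j : ℤ) + 1)) (fun _ _ => inv_nonneg.2 hR)
    (fun j _ => h.inv_le_a _ ⟨by omega, by omega⟩)
  rwa [Finset.prod_const, Finset.card_univ, Fintype.card_fin] at hprod

theorem norm_floquet_apply_le (h : J.CoeffBound q R) (θ : ℝ) (j k : Fin q) : ‖J.floquet q θ j k‖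
    ≤ (if j = k then R else 0) + (if (k : ℕ) = j + 1 then R else 0)
      + (if (j : ℕ) = k + 1 then R else 0) + (if (j : ℕ) = 0 ∧ (k : ℕ) + 1 = q then R else 0)
      + (if (j : ℕ) + 1 = q ∧ (k : ℕ) = 0 then R else 0) := by
  rw [floquet, Matrix.of_apply]
  refine norm_add_le_of_le (norm_add_le_of_le (norm_add_le_of_le (norm_add_le_of_le ?_ ?_)
    ?_) ?_) ?_
  all_goals split_ifs <;> simp [Complex.norm_exp, h.abs_b_add_one_le, h.abs_a_add_one_le,
    h.abs_a_last_le j.pos]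

theorem abs_eigenvalue_le (h : J.CoeffBound q R) (j : Fin q) (θ : ℝ) :
    |J.eigenvalue q j θ| ≤ 5 * R := by
  have hR : 0 ≤ R := zero_le_one.trans (h.one_le j.pos)
  rw [← Real.norm_eq_abs, ← Complex.norm_real]
  refine norm_le_of_hasEigenvalue_of_sum_norm_le (J.hasEigenvalue_eigenvalue q j θ) fun i => ?_
  refine (Finset.sum_le_sum fun k _ => h.norm_floquet_apply_le θ i k).trans ?_
  simp only [Finset.sum_add_distrib]
  rw [show 5 * R = R + R + R + R + R by ring]
  gcongr <;> refine sum_ite_le_of_subsingleton _ (fun k hk l hl => ?_) hR <;>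
    simp only [mem_ofPred_eq] at hk hl <;> omega

theorem norm_velocityOp_le (h : J.CoeffBound q R) (θ : ℝ) :
    ‖J.velocityOp q θ‖ ≤ (q : ℝ) ^ 2 * (4 * R) := by
  have hentry : ∀ j k, ‖J.velocity q θ j k‖ ≤ 4 * R := fun j k => by
    have hR : 0 ≤ R := zero_le_one.trans (h.one_le j.pos)
    rw [velocity, Matrix.of_apply, show 4 * R = R + R + R + R by ring]
    refine norm_add_le_of_le (norm_add_le_of_le (norm_add_le_of_le ?_ ?_) ?_) ?_
    all_goals split_ifs <;> simp [Complex.norm_exp, h.abs_a_add_one_le, h.abs_a_last_le j.pos, hR]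
  simpa only [Fintype.card_fin] using norm_toEuclideanCLM_le_of_norm_apply_le hentry

theorem sin_sq_le_mul_gap (h : J.CoeffBound q R) (θ : ℝ) {j k : Fin q} (hjk : j ≠ k) :
    Real.sin θ ^ 2 ≤ (10 * R ^ 2) ^ q * |J.eigenvalue q j θ - J.eigenvalue q k θ| := by
  have hR := h.one_le j.pos
  have hgap := (mul_le_mul_of_nonneg_right (h.inv_pow_le_hopProd (by linarith))
    (sq_nonneg (Real.sin θ))).trans (J.hopProd_mul_sin_sq_le_mul_gap
      (fun i => h.abs_eigenvalue_le i θ) (by linarith) hjk)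
  rw [inv_pow, inv_mul_le_iff₀ (by positivity)] at hgap
  refine hgap.trans_eq ?_
  rw [show 10 * R ^ 2 = R * (2 * (5 * R)) by ring, mul_pow R, mul_assoc]

theorem norm_asymptoticVelocity_sub_averagedVelocity_le
    (h : J.CoeffBound q R) (hR : 0 < R) {θ t α : ℝ} (hθ : Real.sin θ ≠ 0) (ht : 0 < t)
    (hα : α ∈ Icc (0 : ℝ) 1) :
    ‖J.asymptoticVelocity q θ - J.averagedVelocity q θ t‖
      ≤ 4 * R * q ^ 4 * (2 * (10 * R ^ 2) ^ q / (t * Real.sin θ ^ 2)) ^ α := by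
  have hpow : 0 < (10 * R ^ 2) ^ q := by positivity
  have hgap : ∀ j k : Fin q, j ≠ k → Real.sin θ ^ 2 / (10 * R ^ 2) ^ q
      ≤ |J.eigenvalue q j θ - J.eigenvalue q k θ| := fun j k hjk =>
    (div_le_iff₀' hpow).2 (h.sin_sq_le_mul_gap θ hjk)
  have hbound := norm_sub_heisenbergAverage_le (J.floquetOp_eigenbasis q θ)
    (J.asymptoticVelocity_eigenbasis hθ) (by positivity) hgap ht hα
  have hratio : 2 / (t * (Real.sin θ ^ 2 / (10 * R ^ 2) ^ q))
      = 2 * (10 * R ^ 2) ^ q / (t * Real.sin θ ^ 2) := by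
    rw [← mul_div_assoc, div_div_eq_mul_div]
  rw [hratio, Fintype.card_fin] at hbound
  calc ‖J.asymptoticVelocity q θ - J.averagedVelocity q θ t‖
      ≤ (q : ℝ) ^ 2 * ((2 * (10 * R ^ 2) ^ q / (t * Real.sin θ ^ 2)) ^ α
        * ((q : ℝ) ^ 2 * (4 * R))) := by
        refine hbound.trans ?_
        gcongr
        exact h.norm_velocityOp_le θ
    _ = _ := by ring

theorem sq_norm_asymptoticVelocity_sub_averagedVelocity_le
    (h : J.CoeffBound q R) (hR : 0 < R) {θ t α : ℝ} (hθ : Real.sin θ ≠ 0) (ht : 0 < t)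
    (hα : α ∈ Icc (0 : ℝ) 1) :
    ‖J.asymptoticVelocity q θ - J.averagedVelocity q θ t‖ ^ 2
      ≤ (4 * R * q ^ 4 * (2 * (10 * R ^ 2) ^ q / t) ^ α) ^ 2 * |Real.sin θ| ^ (-(4 * α)) := by
  have hsin : 0 < |Real.sin θ| := abs_pos.2 hθ
  have hrpow : ((Real.sin θ ^ 2) ^ α) ^ 2 = |Real.sin θ| ^ (4 * α) := by
    rw [← sq_abs (Real.sin θ), ← Real.rpow_natCast |Real.sin θ| 2, ← Real.rpow_mul hsin.le,
      ← Real.rpow_natCast _ 2, ← Real.rpow_mul hsin.le]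
    congr 1
    push_cast
    ring
  calc ‖J.asymptoticVelocity q θ - J.averagedVelocity q θ t‖ ^ 2
      ≤ (4 * R * q ^ 4 * (2 * (10 * R ^ 2) ^ q / (t * Real.sin θ ^ 2)) ^ α) ^ 2 := by
        gcongr
        exact h.norm_asymptoticVelocity_sub_averagedVelocity_le hR hθ ht hα
    _ = _ := by
        rw [← div_div, Real.div_rpow (by positivity) (by positivity), ← mul_div_assoc, div_pow,
          hrpow, Real.rpow_neg hsin.le, div_eq_mul_inv]

theorem intervalIntegrable_sq_norm_asymptoticVelocity_sub_averagedVelocity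
    (h : J.CoeffBound q R) (hR : 0 < R) {t : ℝ} (ht : 0 < t) :
    IntervalIntegrable (fun θ => ‖J.asymptoticVelocity q θ - J.averagedVelocity q θ t‖ ^ 2)
      volume 0 (2 * Real.pi) := by
  have hconst : IntervalIntegrable (fun _ : ℝ => (4 * R * (q : ℝ) ^ 4) ^ 2) volume
    0 (2 * Real.pi) := intervalIntegrable_const
  refine hconst.mono_fun ?_ (ae_restrict_of_ae (ae_sin_ne_zero.mono fun θ hθ => ?_))
  · exact (((aestronglyMeasurable_asymptoticVelocity J q).sub
      (J.continuous_averagedVelocity q t).aestronglyMeasurable).norm.pow 2).restrict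
  · have hbound := h.norm_asymptoticVelocity_sub_averagedVelocity_le hR hθ ht
      (left_mem_Icc.2 zero_le_one)
    rw [Real.rpow_zero, mul_one] at hbound
    simpa only [norm_pow, norm_norm] using
      pow_le_pow_left₀ (norm_nonneg _) (hbound.trans (Real.le_norm_self _)) 2

theorem sqrt_integral_sq_norm_asymptoticVelocity_sub_averagedVelocity_le
    (h : J.CoeffBound q R) (hR : 0 < R) {t α : ℝ} (ht : 0 < t)
    (hα : α ∈ Ico (0 : ℝ) (1 / 4)) :
    √(∫ θ in (0 : ℝ)..(2 * Real.pi),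
        ‖J.asymptoticVelocity q θ - J.averagedVelocity q θ t‖ ^ 2 / (2 * Real.pi))
      ≤ 4 * R * q ^ 4 * (2 * (10 * R ^ 2) ^ q / t) ^ α
        * √((∫ θ in (0 : ℝ)..(2 * Real.pi), |Real.sin θ| ^ (-(4 * α))) / (2 * Real.pi)) := by
  obtain ⟨hα0, hα4⟩ := hα
  set M := 4 * R * q ^ 4 * (2 * (10 * R ^ 2) ^ q / t) ^ α
  have hM : 0 ≤ M := by positivity
  have hle : ∫ θ in (0 : ℝ)..(2 * Real.pi),
        ‖J.asymptoticVelocity q θ - J.averagedVelocity q θ t‖ ^ 2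
      ≤ M ^ 2 * ∫ θ in (0 : ℝ)..(2 * Real.pi), |Real.sin θ| ^ (-(4 * α)) := by
    rw [← intervalIntegral.integral_const_mul]
    exact intervalIntegral.integral_mono_ae Real.two_pi_pos.le
      (h.intervalIntegrable_sq_norm_asymptoticVelocity_sub_averagedVelocity hR ht)
      ((intervalIntegrable_abs_sin_rpow (by linarith) _ _).const_mul _)
      (ae_sin_ne_zero.mono fun θ hθ =>
        h.sq_norm_asymptoticVelocity_sub_averagedVelocity_le hR hθ ht ⟨hα0, by linarith⟩)
  rw [intervalIntegral.integral_div, ← Real.sqrt_sq hM, ← Real.sqrt_mul (sq_nonneg M),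
    ← mul_div_assoc]
  gcongr

end CoeffBound

end JacobiMatrix

theorem mul_pow_four_mul_rpow_mul_le {R S t α : ℝ} (hR : 0 ≤ R) (hS : 0 ≤ S) (ht : 0 < t)
    (hα : α ∈ Icc (0 : ℝ) 1) (q : ℕ) :
    4 * R * q ^ 4 * (2 * (10 * R ^ 2) ^ q / t) ^ α * S
      ≤ ((1 + 8 * R * S) * (8 * (10 * R ^ 2 + 1))) ^ q * t ^ (-α) := by
  obtain ⟨hα0, hα1⟩ := hα
  have hbase : (2 * (10 * R ^ 2) ^ q) ^ α ≤ 2 * (10 * R ^ 2 + 1) ^ q := by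
    have hone : 1 ≤ (10 * R ^ 2 + 1) ^ q := one_le_pow₀ (by nlinarith)
    calc (2 * (10 * R ^ 2) ^ q) ^ α ≤ (2 * (10 * R ^ 2 + 1) ^ q) ^ α := by gcongr; linarith
      _ ≤ 2 * (10 * R ^ 2 + 1) ^ q := Real.rpow_le_self_of_one_le (by linarith) hα1
  have hcube : (q : ℝ) ^ 3 ≤ 8 ^ q := by
    have htwo : (q : ℝ) ≤ 2 ^ q := by exact_mod_cast Nat.lt_two_pow_self.le
    calc (q : ℝ) ^ 3 ≤ (2 ^ q) ^ 3 := by gcongr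
      _ = 8 ^ q := by rw [pow_right_comm]; norm_num
  have hbernoulli : q * (8 * R * S) ≤ (1 + 8 * R * S) ^ q := by
    have hRS : 0 ≤ 8 * R * S := by positivity
    linarith [one_add_mul_le_pow (by linarith : -2 ≤ 8 * R * S) q]
  calc 4 * R * q ^ 4 * (2 * (10 * R ^ 2) ^ q / t) ^ α * S
      = 4 * R * q ^ 4 * ((2 * (10 * R ^ 2) ^ q) ^ α * t ^ (-α)) * S := by
        rw [Real.div_rpow (by positivity) ht.le, Real.rpow_neg ht.le, div_eq_mul_inv]
    _ ≤ 4 * R * q ^ 4 * (2 * (10 * R ^ 2 + 1) ^ q * t ^ (-α)) * S := by gcongr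
    _ = q * (8 * R * S) * ((q : ℝ) ^ 3 * (10 * R ^ 2 + 1) ^ q) * t ^ (-α) := by ring
    _ ≤ (1 + 8 * R * S) ^ q * (8 ^ q * (10 * R ^ 2 + 1) ^ q) * t ^ (-α) := by gcongr
    _ = ((1 + 8 * R * S) * (8 * (10 * R ^ 2 + 1))) ^ q * t ^ (-α) := by rw [mul_pow, mul_pow]

end

theorem theoremt_general {R : ℝ} (hR : 0 < R) {α : ℝ} (hα : α ∈ Ico (0 : ℝ) (1 / 4)) :
    ∃ C₁ : ℝ, 1 < C₁ ∧ ∀ (q : ℕ) (J : JacobiMatrix), J.CoeffBound q R →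
      (∀ θ : ℝ, Real.sin θ ≠ 0 → ∀ j : Fin q, DifferentiableAt ℝ (J.eigenvalue q j) θ) ∧
      ∀ t : ℝ, 0 < t →
        IntervalIntegrable
          (fun θ => ‖J.asymptoticVelocity q θ - J.averagedVelocity q θ t‖ ^ 2)
          volume 0 (2 * Real.pi) ∧
        √(∫ θ in (0 : ℝ)..(2 * Real.pi),
            ‖J.asymptoticVelocity q θ - J.averagedVelocity q θ t‖ ^ 2 / (2 * Real.pi))
          ≤ C₁ ^ q * t ^ (-α) := by
  set S := √((∫ θ in (0 : ℝ)..(2 * Real.pi), |Real.sin θ| ^ (-(4 * α))) / (2 * Real.pi))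
  have hS : 0 ≤ S := Real.sqrt_nonneg _
  refine ⟨(1 + 8 * R * S) * (8 * (10 * R ^ 2 + 1)), ?_, fun q J h =>
    ⟨fun θ hθ => J.differentiableAt_eigenvalue hθ, fun t ht =>
      ⟨h.intervalIntegrable_sq_norm_asymptoticVelocity_sub_averagedVelocity hR ht, ?_⟩⟩⟩
  · exact one_lt_mul_of_le_of_lt (le_add_of_nonneg_right (by positivity)) (by nlinarith)
  · exact (h.sqrt_integral_sq_norm_asymptoticVelocity_sub_averagedVelocity_le hR ht hα).trans
      (mul_pow_four_mul_rpow_mul_le hR.le hS ht ⟨hα.1, by linarith [hα.2]⟩ q)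

theorem theoremt :
    ∀ R : ℝ, 0 < R → ∃ C₁ : ℝ, 1 < C₁ ∧
      ∀ (q : ℕ) (J : JacobiMatrix), J.IsPeriodic q → J ∈ JacobiMatrix.boundedClass R →
        (∀ θ ∈ Ioo (0 : ℝ) (2 * Real.pi), θ ≠ Real.pi →
          ∀ j : Fin q, DifferentiableAt ℝ (J.eigenvalue q j) θ) ∧
        ∀ t : ℝ, 0 < t →
          IntervalIntegrable
            (fun θ => ‖J.asymptoticVelocity q θ - J.averagedVelocity q θ t‖ ^ 2)
            volume 0 (2 * Real.pi) ∧
          Real.sqrt (∫ θ in (0 : ℝ)..(2 * Real.pi),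
              ‖J.asymptoticVelocity q θ - J.averagedVelocity q θ t‖ ^ 2 / (2 * Real.pi))
            ≤ C₁ ^ q * t ^ (-(1 / 5) : ℝ) := by
  intro R hR
  obtain ⟨C₁, hC₁, h⟩ := theoremt_general hR (show (1 / 5 : ℝ) ∈ Ico 0 (1 / 4) by norm_num)
  refine ⟨C₁, hC₁, fun q J _ hJ => ?_⟩
  obtain ⟨hdiff, hbound⟩ := h q J (JacobiMatrix.coeffBound_of_mem_boundedClass hJ q)
  exact ⟨fun θ hθ hπ => hdiff θ (sin_ne_zero_of_mem_Ioo_of_ne_pi hθ hπ), hbound⟩
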